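/- **Setting.** Let $\tilde\Lambda$ be a finite non-empty set and let $c:\tilde\Lambda\to\mathbb R$ be drawn from a Gaussian process with mean $0$ and covariance kernel $k$. Evaluating $\lambda$ in iteration $t$ returns $c(\lambda)+\epsilon_t(\lambda)$ with $\epsilon_t(\lambda)\sim\mathcal N(0,s^2(\lambda))$, $s^2(\lambda)>0$, the noise being independent across iterations and independent of $c$. For a finite collection $S=(\lambda_1,\dots,\lambda_n)$ of points, possibly with repetitions, and values $y\in\mathbb R^n$ observed there, put $A_S=[k(\lambda_i,\lambda_j)]_{i,j}+\mathrm{diag}(s^2(\lambda_i))$, $k_S(\lambda)=[k(\lambda_i,\lambda)]_i$, $\mu_S(\lambda)=k_S(\lambda)^\top A_S^{-1}y$ and $\sigma_S^2(\lambda)=k(\lambda,\lambda)-k_S(\lambda)^\top A_S^{-1}k_S(\lambda)$. For points $\lambda_1,\dots,\lambda_t$ write $\mu_t,\sigma_t$ for these quantities after observing them, and $\sigma_{t|S}$ after observing in addition the points of $S$. Let $\operatorname{cost}:\tilde\Lambda\to(0,\infty)$ have minimum $\operatorname{cost}_{\min}$ and maximum $\operatorname{cost}_{\max}$, and let $\operatorname{cost}(S)$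 be the sum of the costs over $S$. Further parameters are $\overline\delta>0$, $r\in(0,1)$, $\eta_{(1)}>0$, $\eta_{(i+1)}=r\,\eta_{(i)}$, $\varepsilon_{\rm rel},\varepsilon_{\rm abs}\ge 0$, and real numbers $\beta_{(1)}\le\beta_{(2)}\le\cdots$. Put $c_{\min}=\min_{\lambda} c(\lambda)$ and $h=c_{\min}(1+\varepsilon_{\rm rel})+\varepsilon_{\rm abs}$. **Algorithm TruVaRImp.** Start with $L_0=H_0=\emptyset$, $U_0=M_0=\tilde\Lambda$ and $i=1$. In iteration $t=1,2,\dots$: 1. With $\Delta_i(D,v,p)=\sum_{\lambda'\in D}\max\{p^2\beta_{(i)}v(\lambda')-\eta_{(i)}^2,0\}$, choose $\lambda_t$ maximizing over $\lambda\in\tilde\Lambda$ $$\frac{\Delta_i(U_{t-1},\sigma_{t-1}^2,1)-\Delta_i(U_{t-1},\sigma^2_{t-1|\lambda},1)+\Delta_i(M_{t-1},\sigma_{t-1}^2,1+\varepsilon_{\rm rel})-\Delta_i(M_{t-1},\sigma^2_{t-1|\lambda},1+\varepsilon_{\rm rel})}{\operatorname{cost}(\lambda)},$$ ties being broken by a fixed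 deterministic rule; observe the noisy value at $\lambda_t$. 2. Put $l_t=\mu_t-\beta_{(i)}^{1/2}\sigma_t$, $u_t=\mu_t+\beta_{(i)}^{1/2}\sigma_t$, $c^{\rm pes}_t=\min_{M_{t-1}}u_t$, $h^{\rm pes}_t=c^{\rm pes}_t(1+\varepsilon_{\rm rel})+\varepsilon_{\rm abs}$ and $h^{\rm opt}_t=(\min_{M_{t-1}}l_t)(1+\varepsilon_{\rm rel})+\varepsilon_{\rm abs}$. 3. Each $\lambda\in U_{t-1}$ is added to $L$ if $u_t(\lambda)\le h_t^{\rm opt}$, otherwise added to $H$ if $l_t(\lambda)>h_t^{\rm pes}$, and otherwise stays in $U_t$. Put $M_t=\{\lambda\in M_{t-1}: l_t(\lambda)\le c_t^{\rm pes}\}$. 4. While $\beta_{(i)}^{1/2}\sigma_t\le(1+\overline\delta)\eta_{(i)}$ on $U_t$ and $\beta_{(i)}^{1/2}\sigma_t\le\frac{1+\overline\delta}{1+\varepsilon_{\rm rel}}\eta_{(i)}$ on $M_t$, increase $i$ by $1$. 5. If the budget is exhausted, i.e. if $\sum_{s\le t}\operatorname{cost}(\lambda_s)$ is at least the given budget,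 return $(L_t,H_t,U_t)$. **Hard sets and covering cost.** Let $\overline U_{(0)}=\overline M_{(0)}=\tilde\Lambda$ and, for $i\ge1$, $\overline U_{(i)}=\{\lambda:|c(\lambda)-h|\le4(1+\overline\delta)\eta_{(i)}\}$ and $\overline M_{(i)}=\{\lambda:c(\lambda)\le c_{\min}+4\frac{1+\overline\delta}{1+\varepsilon_{\rm rel}}\eta_{(i)}\}$. Let $C^*(a,b;U,M)$ be the minimum of $\operatorname{cost}(S)$ over finite collections $S$, possibly with repetitions, with $\sigma_{0|S}\le a$ on $U$ and $\sigma_{0|S}\le b$ on $M$. **Theorem.** Assume that $k(\lambda,\lambda)\le1$ for all $\lambda$, and that for all points $\lambda_1,\dots,\lambda_t$ and every $\lambda$ the set function $S\mapsto\sigma_t^2(\lambda)-\sigma_{t|S}^2(\lambda)$ is submodular. Let $\epsilon>0$ and $\delta\in(0,1)$. Then with probability at least $1-\delta$ the following holds for all real $C_{(1)},C_{(2)},\dots$ (which may depend on $c$). If for every $i\ge1$, with $\log^+=\max(\log,0)$, $$C_{(i)}\ge C^*\Big(\tfrac{\eta_{(i)}}{\beta_{(i)}^{1/2}},\tfrac{\eta_{(i)}}{\beta_{(i)}^{1/2}(1+\varepsilon_{\rm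 rel})};\overline U_{(i-1)},\overline M_{(i-1)}\Big)\log^+\Big(\beta_{(i)}\tfrac{|\overline U_{(i-1)}|+(1+\varepsilon_{\rm rel})^2|\overline M_{(i-1)}|}{\overline\delta^2\eta_{(i)}^2}\Big)+\operatorname{cost}_{\max}$$ and $$\beta_{(i)}\ge2\log\frac{|\tilde\Lambda|\,\big(\sum_{i'\le i}C_{(i')}\big)^2\pi^2}{6\,\delta\operatorname{cost}_{\min}^2},$$ and TruVaRImp is run until its cumulative cost reaches $$C_\epsilon=\sum_{i\ge1:\ 8(1+\overline\delta)\eta_{(i-1)}>\epsilon}C_{(i)}\qquad(\text{with }\eta_{(0)}:=\infty),$$ then the sets $(L,H,U)$ that it returns are $\epsilon$-accurate: $c(\lambda)\le h$ for all $\lambda\in L$, $c(\lambda)>h$ for all $\lambda\in H$, and $|h-c(\lambda)|\le\epsilon/2$ for all $\lambda\in U$. If moreover $k(\lambda,\lambda)>0$ for all $\lambda$, the run does return (no while loop runs forever). -/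

import Mathlib

open MeasureTheory ProbabilityTheory
open scoped NNReal ENNReal

namespace TruVaRImp

/-! ### Gaussian process posterior -/

section Posterior

variable {X ι : Type*} [Fintype ι] [DecidableEq ι]

/-- `K + Σ` for the evaluation points `p` (a finite family, repetitions allowed):
the kernel matrix plus the diagonal matrix of the noise variances. -/
def gram (k : X → X → ℝ) (s2 : X → ℝ≥0) (p : ι → X) : Matrix ι ι ℝ :=
  Matrix.of (fun i j => k (p i) (p j)) + Matrix.diagonal (fun i => (s2 (p i) : ℝ))

/-- The cross-covariance vector between the evaluation points `p` and the point `x`. -/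
def crossCov (k : X → X → ℝ) (p : ι → X) (x : X) : ι → ℝ := fun i => k (p i) x

/-- Posterior mean at `x` given the noisy values `y` observed at the points `p` (zero prior mean). -/
noncomputable def postMean (k : X → X → ℝ) (s2 : X → ℝ≥0) (p : ι → X) (y : ι → ℝ) (x : X) : ℝ :=
  crossCov k p x ⬝ᵥ ((gram k s2 p)⁻¹.mulVec y)

/-- Posterior variance at `x` given noisy observations at the points `p`. -/
noncomputable def postVar (k : X → X → ℝ) (s2 : X → ℝ≥0) (p : ι → X) (x : X) : ℝ :=
  k x x - crossCov k p x ⬝ᵥ ((gram k s2 p)⁻¹.mulVec (crossCov k p x))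

/-- Posterior standard deviation. -/
noncomputable def postStd (k : X → X → ℝ) (s2 : X → ℝ≥0) (p : ι → X) (x : X) : ℝ :=
  √(postVar k s2 p x)

end Posterior

/-- For any points `p` already selected and any query point `x`, the reduction
`ψ(S) = σ²_p(x) - σ²_{p ∪ S}(x)` of the posterior variance obtained by additionally observing every
point of `S` is a submodular function of the finite set `S`. -/
def SubmodularVarianceReduction {X : Type*} [DecidableEq X] (k : X → X → ℝ) (s2 : X → ℝ≥0) : Prop :=
  ∀ (t : ℕ) (p : Fin t → X) (x : X),
    let ψ : Finset X → ℝ := fun S =>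
      postVar k s2 p x - postVar k s2 (Sum.elim p (fun s : S => (s : X))) x
    ∀ A B : Finset X, ψ (A ∪ B) + ψ (A ∩ B) ≤ ψ A + ψ B

/-! ### The algorithm -/

/-- The input of the algorithm, apart from the objective and the noise.
`β i` is used for epochs `i ≥ 1` only. -/
structure Config (X : Type*) where
  /-- prior covariance kernel -/
  k : X → X → ℝ
  /-- variance of the observation noise at each point -/
  noiseVar : X → ℝ≥0
  /-- evaluation cost -/
  cost : X → ℝ
  /-- slack parameter `δ̄` -/
  slack : ℝ
  /-- reduction factor `r` -/
  r : ℝ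
  /-- initial target confidence `η₍₁₎` -/
  eta1 : ℝ
  /-- confidence parameters `β₍ᵢ₎` -/
  β : ℕ → ℝ
  /-- relative offset -/
  εrel : ℝ
  /-- absolute offset -/
  εabs : ℝ

/-- The state after `t` iterations: points evaluated so far and the values observed there, the sets
`L, H, U, M`, and the current epoch number. -/
structure State (X : Type*) (t : ℕ) where
  pts : Fin t → X
  obs : Fin t → ℝ
  L : Finset X
  H : Finset X
  U : Finset X
  M : Finset X
  epoch : ℕ

namespace Config

variable {X : Type*} (cfg : Config X)

/-- Target confidence in epoch `i ≥ 1`: `η₍₁₎ = eta1` and `η₍ᵢ₊₁₎ = r η₍ᵢ₎`. -/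
noncomputable def η (i : ℕ) : ℝ := cfg.eta1 * cfg.r ^ (i - 1)

/-- The scaled excess variance `Δᵢ(D, v, p)`. -/
noncomputable def excess (i : ℕ) (D : Finset X) (v : X → ℝ) (p : ℝ) : ℝ :=
  ∑ x ∈ D, max (p ^ 2 * cfg.β i * v x - cfg.η i ^ 2) 0

/-- Acquisition value of evaluating `x` next: the reduction of the excess variance per cost, where
the look-ahead variance is that after one more observation at `x`. -/
noncomputable def acquisition {t : ℕ} (s : State X t) (x : X) : ℝ :=
  let v : X → ℝ := postVar cfg.k cfg.noiseVar s.pts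
  let v' : X → ℝ := postVar cfg.k cfg.noiseVar (Fin.snoc (α := fun _ => X) s.pts x)
  ((cfg.excess s.epoch s.U v 1 - cfg.excess s.epoch s.U v' 1)
    + (cfg.excess s.epoch s.M v (1 + cfg.εrel) - cfg.excess s.epoch s.M v' (1 + cfg.εrel)))
    / cfg.cost x

open scoped Classical in
/-- The set of maximizers of the acquisition function. -/
noncomputable def argmaxSet [Fintype X] {t : ℕ} (s : State X t) : Finset X :=
  Finset.univ.filter (fun x => ∀ x', cfg.acquisition s x' ≤ cfg.acquisition s x)

/-- Lower end of the confidence interval at `x`, from the values `y` observed at `p`, with `β₍ᵢ₎`. -/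
noncomputable def lower {t : ℕ} (i : ℕ) (p : Fin t → X) (y : Fin t → ℝ) (x : X) : ℝ :=
  postMean cfg.k cfg.noiseVar p y x - √(cfg.β i) * postStd cfg.k cfg.noiseVar p x

/-- Upper end of the confidence interval at `x`, from the values `y` observed at `p`, with `β₍ᵢ₎`. -/
noncomputable def upper {t : ℕ} (i : ℕ) (p : Fin t → X) (y : Fin t → ℝ) (x : X) : ℝ :=
  postMean cfg.k cfg.noiseVar p y x + √(cfg.β i) * postStd cfg.k cfg.noiseVar p x

/-- The condition of the `while` loop that advances the epoch number, at epoch number `i`. -/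
def epochDone {t : ℕ} (p : Fin t → X) (U M : Finset X) (i : ℕ) : Prop :=
  (∀ x ∈ U, √(cfg.β i) * postStd cfg.k cfg.noiseVar p x ≤ (1 + cfg.slack) * cfg.η i) ∧
  (∀ x ∈ M, √(cfg.β i) * postStd cfg.k cfg.noiseVar p x
    ≤ (1 + cfg.slack) / (1 + cfg.εrel) * cfg.η i)

/-- Epoch number after the `while` loop started at `i`: the first `j ≥ i` where the loop condition
fails. (The value is meaningless if there is no such `j`, i.e. if the loop runs forever; see
`ReturnsAt`.) -/
noncomputable def nextEpoch {t : ℕ} (p : Fin t → X) (U M : Finset X) (i : ℕ) : ℕ :=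
  sInf {j | i ≤ j ∧ ¬ cfg.epochDone p U M j}

/-- State before the first iteration. -/
def init [Fintype X] : State X 0 where
  pts := Fin.elim0
  obs := Fin.elim0
  L := ∅
  H := ∅
  U := Finset.univ
  M := Finset.univ
  epoch := 1

open scoped Classical in
/-- One iteration. `pick` breaks ties in the arg max; `y x` is the noisy value that is observed if
the point `x` is evaluated in this iteration. -/
noncomputable def step [Fintype X] (pick : Finset X → X) (y : X → ℝ) {t : ℕ} (s : State X t) :
    State X (t + 1) :=
  let x₀ : X := pick (cfg.argmaxSet s)
  let p : Fin (t + 1) → X := Fin.snoc (α := fun _ => X) s.pts x₀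
  let o : Fin (t + 1) → ℝ := Fin.snoc (α := fun _ => ℝ) s.obs (y x₀)
  let l : X → ℝ := cfg.lower s.epoch p o
  let u : X → ℝ := cfg.upper s.epoch p o
  let cpes : ℝ := ⨅ x : s.M, u x
  let hpes : ℝ := cpes * (1 + cfg.εrel) + cfg.εabs
  let hopt : ℝ := (⨅ x : s.M, l x) * (1 + cfg.εrel) + cfg.εabs
  let U : Finset X := s.U.filter (fun x => ¬ u x ≤ hopt ∧ ¬ hpes < l x)
  let M : Finset X := s.M.filter (fun x => l x ≤ cpes)
  { pts := p
    obs := o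
    L := s.L ∪ s.U.filter (fun x => u x ≤ hopt)
    H := s.H ∪ s.U.filter (fun x => ¬ u x ≤ hopt ∧ hpes < l x)
    U := U
    M := M
    epoch := cfg.nextEpoch p U M s.epoch }

/-- The run of the algorithm on the objective `c`, where `e t x` is the noise that is added if `x`
is evaluated in iteration `t + 1`, and `pick t` breaks ties in iteration `t + 1`. -/
noncomputable def run [Fintype X] (pick : ℕ → Finset X → X) (c : X → ℝ) (e : ℕ → X → ℝ) :
    (t : ℕ) → State X t
  | 0 => init
  | t + 1 => cfg.step (pick t) (fun x => c x + e t x) (run pick c e t)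

/-- Cumulative cost of the evaluations made up to the state `s`. -/
def totalCost {t : ℕ} (s : State X t) : ℝ := ∑ j, cfg.cost (s.pts j)

/-- The `while` loop of iteration `t + 1` of the run terminates. -/
def LoopHalts [Fintype X] (pick : ℕ → Finset X → X) (c : X → ℝ) (e : ℕ → X → ℝ) (t : ℕ) : Prop :=
  ∃ j, (cfg.run pick c e t).epoch ≤ j ∧
    ¬ cfg.epochDone (cfg.run pick c e (t + 1)).pts (cfg.run pick c e (t + 1)).U
      (cfg.run pick c e (t + 1)).M j

/-- The algorithm, run until its cumulative cost reaches `B`, returns at the end of iteration `T`: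
all its inner loops up to then terminate, and `T` is the first iteration after which the cumulative
cost is at least `B`. -/
def ReturnsAt [Fintype X] (pick : ℕ → Finset X → X) (c : X → ℝ) (e : ℕ → X → ℝ)
    (B : ℝ) (T : ℕ) : Prop :=
  1 ≤ T ∧ (∀ t < T, cfg.LoopHalts pick c e t) ∧
  B ≤ cfg.totalCost (cfg.run pick c e T) ∧
  ∀ t, 1 ≤ t → t < T → cfg.totalCost (cfg.run pick c e t) < B

/-! ### Threshold, accuracy, hard sets and the conditions on the constants -/

/-- The implicit threshold `h = c_min (1 + ε_rel) + ε_abs`. -/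
noncomputable def threshold (c : X → ℝ) : ℝ := (⨅ x, c x) * (1 + cfg.εrel) + cfg.εabs

/-- `ε`-accuracy of the triple `(L, H, U)` of the state `s`. -/
def Accurate (c : X → ℝ) (ε : ℝ) {t : ℕ} (s : State X t) : Prop :=
  (∀ x ∈ s.L, c x ≤ cfg.threshold c) ∧
  (∀ x ∈ s.H, cfg.threshold c < c x) ∧
  (∀ x ∈ s.U, |cfg.threshold c - c x| ≤ ε / 2)

open scoped Classical in
/-- The hard set of unclassified points after epoch `i`; every point for `i = 0`. -/
noncomputable def hardU [Fintype X] (c : X → ℝ) (i : ℕ) : Finset X :=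
  if i = 0 then Finset.univ else
    Finset.univ.filter (fun x => |c x - cfg.threshold c| ≤ 4 * (1 + cfg.slack) * cfg.η i)

open scoped Classical in
/-- The hard set of potential minimizers after epoch `i`; every point for `i = 0`. -/
noncomputable def hardM [Fintype X] (c : X → ℝ) (i : ℕ) : Finset X :=
  if i = 0 then Finset.univ else
    Finset.univ.filter
      (fun x => c x ≤ (⨅ x', c x') + 4 * ((1 + cfg.slack) / (1 + cfg.εrel)) * cfg.η i)

/-- `C*(a, b; U, M)`: the least cost of a finite collection `S` of points, possibly with duplicates,
after whose observation the posterior standard deviation is at most `a` on `U` and at most `b`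
on `M`. -/
noncomputable def coverCost (a b : ℝ) (U M : Finset X) : ℝ :=
  sInf {B | ∃ (n : ℕ) (S : Fin n → X), B = ∑ j, cfg.cost (S j) ∧
    (∀ x ∈ U, postStd cfg.k cfg.noiseVar S x ≤ a) ∧
    (∀ x ∈ M, postStd cfg.k cfg.noiseVar S x ≤ b)}

/-- The condition on the per-epoch cost bounds `C i`, `i ≥ 1`, for the objective `c`. -/
def CostBound [Fintype X] (c : X → ℝ) (C : ℕ → ℝ) : Prop :=
  ∀ i, 1 ≤ i →
    cfg.coverCost (cfg.η i / √(cfg.β i)) (cfg.η i / (√(cfg.β i) * (1 + cfg.εrel)))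
        (cfg.hardU c (i - 1)) (cfg.hardM c (i - 1))
      * max (Real.log (cfg.β i *
          (((cfg.hardU c (i - 1)).card : ℝ) + (1 + cfg.εrel) ^ 2 * (cfg.hardM c (i - 1)).card)
          / (cfg.slack ^ 2 * cfg.η i ^ 2))) 0
      + (⨆ x, cfg.cost x) ≤ C i

/-- The condition on the confidence parameters `β i`, `i ≥ 1`. -/
def ConfidenceBound [Fintype X] (δ : ℝ) (C : ℕ → ℝ) : Prop :=
  ∀ i, 1 ≤ i →
    2 * Real.log ((Fintype.card X : ℝ) * (∑ j ∈ Finset.Icc 1 i, C j) ^ 2 * Real.pi ^ 2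
      / (6 * δ * (⨅ x, cfg.cost x) ^ 2)) ≤ cfg.β i

/-- The budget `C_ε = ∑ C i` over the epochs `i ≥ 1` with `8 (1 + δ̄) η₍ᵢ₋₁₎ > ε`, where `η₍₀₎ = ∞`,
so that `i = 1` always belongs to the sum. -/
noncomputable def budget (ε : ℝ) (C : ℕ → ℝ) : ℝ :=
  ∑ᶠ i ∈ {i : ℕ | i = 1 ∨ (2 ≤ i ∧ ε < 8 * (1 + cfg.slack) * cfg.η (i - 1))}, C i

end Config

end TruVaRImp

/-!
The proof separates a probabilistic part, which produces the event on which all confidence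
intervals used by the algorithm are valid, from a deterministic analysis of a single run on that
event.

*Confidence.* The points are chosen adaptively, so the observations are not Gaussian. However, the
event that the first `t` points are a given sequence `p` depends only on the noisy values at the
fixed points `p` (`run_pts_eq_iff`, `measurableSet_obsRun_pts`). These are jointly Gaussian with the
objective, hence independent of the error of the posterior mean, which is centred normal with the
posterior variance (`posterior_error`). Summing over `p` gives the tail bound `exp (-a² / 2)` for
the error at adaptively chosen points (`measure_error_gt_le`), and with the width factors
`confBeta`, of order `2 log t²`, the union bound over points and iterations costs `δ` in total
because `∑ 1 / t² = π² / 6` (`exists_confidenceValid`).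

*Cost of an epoch.* Submodularity gives diminishing returns: an observation is worth at most as much
after further observations as before (`gain_snoc_le`; for a repeated point, which submodularity on
sets does not cover, this follows from the update formula `postCov_snoc`). So the greedy choice
shrinks the excess variance by the factor `1 - cost / B` when some family of cost at most `B` would
remove it (`potential_greedy`). An epoch that is not done has excess variance above `δ̄² η²`
(`lt_potential_of_not_epochDone`), and hence its cost is bounded by a covering cost times a
logarithm (`Invariant.totalCost_add_le`).

*Correctness.* While the confidence intervals are valid, points are classified correctly, and once
the intervals are narrow the surviving points lie in the hard sets (`step_hard`). The two parts
depend on each other: hard sets bound the cost of the next epoch, and the cost bounds the number of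
observations, so that `β` of the current epoch is at least `confBeta`. They are therefore proved
together, as an invariant of the run (`invariant_run`).
-/

namespace TruVaRImp

/-! ### Posterior variance as the least mean squared error -/

section PosteriorVariance

variable {X ι κ : Type*} {k : X → X → ℝ} {s2 : X → ℝ≥0}

/-- Mean squared error of the linear predictor `∑ wᵢ yᵢ` of the objective at `x` from the noisy
values `yᵢ` at the points `p i`. -/
def mse [Fintype ι] (k : X → X → ℝ) (s2 : X → ℝ≥0) (p : ι → X) (x : X) (w : ι → ℝ) : ℝ :=
  k x x - 2 * ∑ i, w i * k (p i) x + ∑ i, ∑ j, w i * w j * k (p i) (p j)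
    + ∑ i, (s2 (p i) : ℝ) * w i ^ 2

theorem kernel_symm (hK : (Matrix.of k).PosSemidef) (x y : X) : k x y = k y x := by
  simpa using (hK.isHermitian.apply x y).symm

theorem quadForm_nonneg [Fintype κ] (hK : (Matrix.of k).PosSemidef) (q : κ → X) (v : κ → ℝ) :
    0 ≤ ∑ i, ∑ j, v i * v j * k (q i) (q j) := by
  have h := (hK.submatrix q).dotProduct_mulVec_nonneg v
  simp only [dotProduct, Matrix.mulVec, Matrix.submatrix_apply, Matrix.of_apply, Finset.mul_sum,
    Pi.star_apply, star_trivial] at h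
  refine h.trans_eq (Finset.sum_congr rfl fun i _ => Finset.sum_congr rfl fun j _ => by ring)

/-- The error consists of the noise part and of the variance of `c x - ∑ wᵢ c (p i)`, a value of the
kernel's quadratic form. -/
theorem noise_le_mse [Fintype ι] (hK : (Matrix.of k).PosSemidef) (p : ι → X) (x : X) (w : ι → ℝ) :
    ∑ i, (s2 (p i) : ℝ) * w i ^ 2 ≤ mse k s2 p x w := by
  have h := quadForm_nonneg hK (fun o : Option ι => o.elim x p) (fun o => o.elim 1 (fun i => -w i))
  simp only [Fintype.sum_option, Option.elim] at h
  have h2 : ∑ i, (-w i * k (p i) x) = ∑ i, (-w i * k x (p i)) :=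
    Finset.sum_congr rfl fun i _ => by rw [kernel_symm hK]
  simp only [Finset.sum_add_distrib, mul_one, one_mul, neg_mul, Finset.sum_neg_distrib, mul_neg,
    neg_neg] at h h2
  unfold mse
  linarith

variable [DecidableEq ι]

theorem gram_posDef (hK : (Matrix.of k).PosSemidef) (hs : ∀ x, 0 < s2 x) (p : ι → X) :
    (gram k s2 p).PosDef := by
  refine Matrix.PosDef.posSemidef_add (hK.submatrix p) (Matrix.PosDef.diagonal fun i => ?_)
  exact_mod_cast hs (p i)

theorem gram_transpose (hK : (Matrix.of k).PosSemidef) (p : ι → X) :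
    (gram k s2 p).transpose = gram k s2 p := by
  ext i j
  simp only [gram, Matrix.transpose_apply, Matrix.add_apply, Matrix.of_apply,
    Matrix.diagonal_apply, kernel_symm hK (p j)]
  congr 1
  by_cases h : i = j
  · subst h; rfl
  · simp [h, Ne.symm h]

variable [Fintype ι] [Fintype κ]

theorem mse_eq_dotProduct (p : ι → X) (x : X) (w : ι → ℝ) :
    mse k s2 p x w
      = k x x - 2 * (w ⬝ᵥ crossCov k p x) + w ⬝ᵥ (gram k s2 p).mulVec w := by
  have h : w ⬝ᵥ (gram k s2 p).mulVec w
      = ∑ i, ∑ j, w i * w j * k (p i) (p j) + ∑ i, (s2 (p i) : ℝ) * w i ^ 2 := by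
    rw [gram, Matrix.add_mulVec, dotProduct_add]
    congr 1
    · simp only [dotProduct, Matrix.mulVec, Matrix.of_apply, Finset.mul_sum]
      exact Finset.sum_congr rfl fun i _ => Finset.sum_congr rfl fun j _ => by ring
    · simp only [dotProduct, Matrix.mulVec_diagonal]
      exact Finset.sum_congr rfl fun i _ => by ring
  rw [h, mse]
  simp only [dotProduct, crossCov]
  ring

theorem isUnit_det_gram (hK : (Matrix.of k).PosSemidef) (hs : ∀ x, 0 < s2 x) (p : ι → X) :
    IsUnit (gram k s2 p).det :=
  (Matrix.isUnit_iff_isUnit_det _).1 (gram_posDef hK hs p).isUnit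

/-- Weights of the posterior mean at `x`, the best linear predictor. -/
noncomputable def weights (k : X → X → ℝ) (s2 : X → ℝ≥0) (p : ι → X) (x : X) : ι → ℝ :=
  (gram k s2 p)⁻¹.mulVec (crossCov k p x)

theorem gram_mulVec_weights (hK : (Matrix.of k).PosSemidef) (hs : ∀ x, 0 < s2 x) (p : ι → X)
    (x : X) : (gram k s2 p).mulVec (weights k s2 p x) = crossCov k p x := by
  rw [weights, Matrix.mulVec_mulVec, Matrix.mul_nonsing_inv _ (isUnit_det_gram hK hs p),
    Matrix.one_mulVec]

theorem dotProduct_gram_mulVec_comm (hK : (Matrix.of k).PosSemidef) (p : ι → X) (v w : ι → ℝ) :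
    v ⬝ᵥ (gram k s2 p).mulVec w = w ⬝ᵥ (gram k s2 p).mulVec v := by
  rw [Matrix.dotProduct_mulVec, ← Matrix.mulVec_transpose, gram_transpose hK, dotProduct_comm]

/-- Completing the square: the posterior variance is the least mean squared error. -/
theorem mse_eq_postVar_add (hK : (Matrix.of k).PosSemidef) (hs : ∀ x, 0 < s2 x) (p : ι → X)
    (x : X) (w : ι → ℝ) :
    mse k s2 p x w = postVar k s2 p x
      + (w - weights k s2 p x) ⬝ᵥ (gram k s2 p).mulVec (w - weights k s2 p x) := by
  have h1 := gram_mulVec_weights hK hs p x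
  have h2 := dotProduct_gram_mulVec_comm (s2 := s2) hK p (weights k s2 p x) w
  rw [mse_eq_dotProduct, postVar, ← weights, Matrix.mulVec_sub, sub_dotProduct, dotProduct_sub,
    dotProduct_sub, h2, h1, dotProduct_comm (crossCov k p x)]
  ring

theorem postVar_le_mse (hK : (Matrix.of k).PosSemidef) (hs : ∀ x, 0 < s2 x) (p : ι → X)
    (x : X) (w : ι → ℝ) : postVar k s2 p x ≤ mse k s2 p x w := by
  rw [mse_eq_postVar_add hK hs]
  have := (gram_posDef hK hs p).posSemidef.dotProduct_mulVec_nonneg (w - weights k s2 p x)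
  simpa using this

theorem mse_weights (hK : (Matrix.of k).PosSemidef) (hs : ∀ x, 0 < s2 x) (p : ι → X) (x : X) :
    mse k s2 p x (weights k s2 p x) = postVar k s2 p x := by
  simp [mse_eq_postVar_add hK hs]

theorem postVar_nonneg (hK : (Matrix.of k).PosSemidef) (hs : ∀ x, 0 < s2 x) (p : ι → X) (x : X) :
    0 ≤ postVar k s2 p x := by
  rw [← mse_weights hK hs]
  exact (Finset.sum_nonneg fun i _ => by positivity).trans (noise_le_mse hK p x _)

/-- Noisy observations never determine a nondegenerate value: an error-free predictor would have
weight zero on every noisy value, and then its error is the prior variance. -/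
theorem postVar_pos (hK : (Matrix.of k).PosSemidef) (hs : ∀ x, 0 < s2 x) (p : ι → X) {x : X}
    (hx : 0 < k x x) : 0 < postVar k s2 p x := by
  refine (postVar_nonneg hK hs p x).lt_of_ne' fun h0 => ?_
  have h := noise_le_mse (s2 := s2) hK p x (weights k s2 p x)
  rw [mse_weights hK hs, h0] at h
  have hw : ∀ i, weights k s2 p x i = 0 := by
    have h' := (Finset.sum_eq_zero_iff_of_nonneg (fun i _ => by positivity)).1
      (h.antisymm (Finset.sum_nonneg fun i _ => by positivity))
    intro i
    have h3 : (0 : ℝ) < s2 (p i) := by exact_mod_cast hs (p i)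
    have := h' i (Finset.mem_univ i)
    rcases mul_eq_zero.1 this with h4 | h4
    · exact absurd h4 h3.ne'
    · exact pow_eq_zero_iff (two_ne_zero) |>.1 h4
  have h5 := mse_weights hK hs p x
  rw [h0] at h5
  simp only [mse, hw] at h5
  simp at h5
  exact hx.ne' h5

theorem postVar_le_prior (hK : (Matrix.of k).PosSemidef) (hs : ∀ x, 0 < s2 x) (p : ι → X)
    (x : X) : postVar k s2 p x ≤ k x x := by
  simpa [mse] using postVar_le_mse hK hs p x 0

/-- More observations never increase the posterior variance: extend the weights by zero. -/
theorem postVar_le_postVar_comp [DecidableEq κ] (hK : (Matrix.of k).PosSemidef)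
    (hs : ∀ x, 0 < s2 x) (q : κ → X)
    {f : ι → κ} (hf : Function.Injective f) (x : X) :
    postVar k s2 q x ≤ postVar k s2 (q ∘ f) x := by
  set w := weights k s2 (q ∘ f) x with hw
  rw [← mse_weights hK hs (q ∘ f)]
  obtain ⟨v, hv, hvf⟩ : ∃ v : κ → ℝ, (∀ g : κ → ℝ, ∑ j, v j * g j = ∑ i, w i * g (f i)) ∧
      ∀ i, v (f i) = w i := by
    refine ⟨fun j => ∑ i, if f i = j then w i else 0, fun g => ?_, fun i => by simp [hf.eq_iff]⟩
    simp only [Finset.sum_mul]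
    rw [Finset.sum_comm]
    exact Finset.sum_congr rfl fun i _ => by simp [ite_mul]
  refine (postVar_le_mse hK hs q x v).trans_eq ?_
  have h2 : ∑ i, ∑ j, v i * v j * k (q i) (q j)
      = ∑ i, ∑ j, w i * w j * k (q (f i)) (q (f j)) := by
    simp only [mul_assoc, ← Finset.mul_sum, hv]
  have h3 : ∑ i, (s2 (q i) : ℝ) * v i ^ 2 = ∑ i, (s2 (q (f i)) : ℝ) * w i ^ 2 := by
    have h := hv (fun j => v j * (s2 (q j) : ℝ))
    simp only [hvf] at h
    rw [show (∑ i, (s2 (q (f i)) : ℝ) * w i ^ 2) = ∑ i, w i * (w i * (s2 (q (f i)) : ℝ)) from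
      Finset.sum_congr rfl fun i _ => by ring, ← h]
    exact Finset.sum_congr rfl fun i _ => by ring
  simp only [mse, Function.comp_apply, hv, h2, h3, ← hw]

theorem postVar_comp_bijective [DecidableEq κ] (hK : (Matrix.of k).PosSemidef)
    (hs : ∀ x, 0 < s2 x) (q : κ → X)
    {f : ι → κ} (hf : Function.Bijective f) (x : X) :
    postVar k s2 (q ∘ f) x = postVar k s2 q x := by
  refine le_antisymm ?_ (postVar_le_postVar_comp hK hs q hf.1 x)
  have h := postVar_le_postVar_comp hK hs (q ∘ f) (Equiv.ofBijective f hf).symm.injective x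
  rwa [Function.comp_assoc, show f ∘ (Equiv.ofBijective f hf).symm = id from
    funext (Equiv.ofBijective f hf).apply_symm_apply, Function.comp_id] at h

/-- The average of `n` noisy values at `x` predicts the objective at `x` with error `s² / n`. -/
theorem postVar_le_of_repeated [DecidableEq κ] (hK : (Matrix.of k).PosSemidef)
    (hs : ∀ x, 0 < s2 x) (q : κ → X)
    {n : ℕ} (hn : 0 < n) {f : Fin n → κ} (hf : Function.Injective f) {x : X}
    (hx : ∀ i, q (f i) = x) : postVar k s2 q x ≤ s2 x / n := by
  refine (postVar_le_postVar_comp hK hs q hf x).trans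
    ((postVar_le_mse hK hs _ x (fun _ => (n : ℝ)⁻¹)).trans_eq ?_)
  have : (n : ℝ) ≠ 0 := by positivity
  simp only [mse, Function.comp_apply, hx, Finset.sum_const, Finset.card_univ, Fintype.card_fin,
    nsmul_eq_mul]
  field_simp
  ring

end PosteriorVariance

/-! ### One more observation -/

section Update

variable {X : Type*} {k : X → X → ℝ} {s2 : X → ℝ≥0} {t : ℕ}

/-- Posterior covariance of the objective at `x` and `y` given noisy values at the points `p`. -/
noncomputable def postCov (k : X → X → ℝ) (s2 : X → ℝ≥0) (p : Fin t → X) (x y : X) : ℝ :=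
  k x y - crossCov k p x ⬝ᵥ weights k s2 p y

theorem postCov_self (p : Fin t → X) (x : X) : postCov k s2 p x x = postVar k s2 p x := rfl

theorem postCov_comm (hK : (Matrix.of k).PosSemidef) (hs : ∀ x, 0 < s2 x) (p : Fin t → X)
    (x y : X) : postCov k s2 p x y = postCov k s2 p y x := by
  rw [postCov, postCov, kernel_symm hK x y, ← gram_mulVec_weights hK hs p x,
    ← gram_mulVec_weights hK hs p y, dotProduct_comm, dotProduct_gram_mulVec_comm hK,
    dotProduct_comm]

/-- The weight vector after one more observation at `b`, by solving the bordered linear system. -/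
theorem weights_snoc (hK : (Matrix.of k).PosSemidef) (hs : ∀ x, 0 < s2 x) (p : Fin t → X)
    (b y : X) :
    weights k s2 (Fin.snoc (α := fun _ => X) p b) y
      = Fin.snoc (α := fun _ => ℝ) (weights k s2 p y
          - (postCov k s2 p b y / (postVar k s2 p b + s2 b)) • weights k s2 p b)
        (postCov k s2 p b y / (postVar k s2 p b + s2 b)) := by
  set γ := postCov k s2 p b y / (postVar k s2 p b + s2 b) with hγ
  have hpos : 0 < postVar k s2 p b + s2 b :=
    add_pos_of_nonneg_of_pos (postVar_nonneg hK hs p b) (by exact_mod_cast hs b)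
  have hγ' : γ * (postVar k s2 p b + s2 b) = postCov k s2 p b y := by
    rw [hγ]; field_simp
  have hinj := Matrix.mulVec_injective_of_isUnit
    (gram_posDef hK hs (Fin.snoc (α := fun _ => X) p b)).isUnit
  apply hinj
  rw [gram_mulVec_weights hK hs]
  have hy := gram_mulVec_weights hK hs p y
  have hb := gram_mulVec_weights hK hs p b
  ext i
  refine Fin.lastCases ?_ (fun i => ?_) i
  · simp only [crossCov, Fin.snoc_last, Matrix.mulVec, dotProduct, Fin.sum_univ_castSucc,
      Fin.snoc_castSucc, gram, Matrix.add_apply, Matrix.of_apply, Matrix.diagonal_apply,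
      Pi.sub_apply, Pi.smul_apply, smul_eq_mul, if_true]
    have hne : ∀ j : Fin t, (Fin.last t = j.castSucc) = False := fun j =>
      eq_false (Fin.castSucc_lt_last j).ne'
    simp only [hne, if_false, add_zero, mul_sub, Finset.sum_sub_distrib]
    have e1 : ∑ j, k b (p j) * weights k s2 p y j = crossCov k p b ⬝ᵥ weights k s2 p y :=
      Finset.sum_congr rfl fun j _ => by rw [crossCov, kernel_symm hK]
    have e2 : ∑ j, k b (p j) * (γ * weights k s2 p b j)
        = γ * (crossCov k p b ⬝ᵥ weights k s2 p b) := by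
      rw [dotProduct, Finset.mul_sum]
      exact Finset.sum_congr rfl fun j _ => by rw [crossCov, kernel_symm hK]; ring
    rw [e1, e2]
    rw [postVar, ← weights, postCov] at hγ'
    linarith
  · have hyi := congrFun hy i
    have hbi := congrFun hb i
    simp only [crossCov, Fin.snoc_last, Matrix.mulVec, dotProduct, Fin.sum_univ_castSucc,
      Fin.snoc_castSucc, gram, Matrix.add_apply, Matrix.of_apply, Matrix.diagonal_apply,
      Pi.sub_apply, Pi.smul_apply, smul_eq_mul, Fin.castSucc_inj] at hyi hbi ⊢
    have hne : ((i.castSucc : Fin (t + 1)) = Fin.last t) = False :=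
      eq_false (Fin.castSucc_lt_last i).ne
    have e3 : ∀ (g : Fin t → ℝ), ∑ j, g j * (γ * weights k s2 p b j)
        = γ * ∑ j, g j * weights k s2 p b j := fun g => by
      rw [Finset.mul_sum]; exact Finset.sum_congr rfl fun j _ => by ring
    simp only [hne, if_false, add_zero, mul_sub, Finset.sum_sub_distrib, e3, hyi, hbi]
    ring

theorem postCov_snoc (hK : (Matrix.of k).PosSemidef) (hs : ∀ x, 0 < s2 x) (p : Fin t → X)
    (b x y : X) :
    postCov k s2 (Fin.snoc (α := fun _ => X) p b) x y
      = postCov k s2 p x y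
        - postCov k s2 p b x * postCov k s2 p b y / (postVar k s2 p b + s2 b) := by
  rw [postCov, weights_snoc hK hs]
  set γ := postCov k s2 p b y / (postVar k s2 p b + s2 b) with hγ
  rw [mul_div_assoc, ← hγ, postCov_comm hK hs p b x, postCov, postCov, kernel_symm hK x b]
  simp only [dotProduct, Fin.sum_univ_castSucc, crossCov, Fin.snoc_castSucc, Fin.snoc_last,
    Pi.sub_apply, Pi.smul_apply, smul_eq_mul, mul_sub, Finset.sum_sub_distrib]
  have e3 : ∀ (g : Fin t → ℝ), ∑ j, g j * (γ * weights k s2 p b j)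
      = γ * ∑ j, g j * weights k s2 p b j := fun g => by
    rw [Finset.mul_sum]; exact Finset.sum_congr rfl fun j _ => by ring
  rw [e3]
  ring

/-- The variance reduction at `x` by one more observation at `b`. -/
noncomputable def gain (k : X → X → ℝ) (s2 : X → ℝ≥0) (p : Fin t → X) (b x : X) : ℝ :=
  postVar k s2 p x - postVar k s2 (Fin.snoc (α := fun _ => X) p b) x

theorem gain_nonneg (hK : (Matrix.of k).PosSemidef) (hs : ∀ x, 0 < s2 x) (p : Fin t → X)
    (b x : X) : 0 ≤ gain k s2 p b x := by
  have h := postVar_le_postVar_comp hK hs (Fin.snoc (α := fun _ => X) p b)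
    (Fin.castSucc_injective t) x
  rw [Fin.snoc_comp_castSucc] at h
  exact sub_nonneg.2 h

/-- A second observation at the same point helps less than the first. -/
theorem gain_snoc_self_le (hK : (Matrix.of k).PosSemidef) (hs : ∀ x, 0 < s2 x) (p : Fin t → X)
    (b x : X) : gain k s2 (Fin.snoc (α := fun _ => X) p b) b x ≤ gain k s2 p b x := by
  have hgain : ∀ {m : ℕ} (q : Fin m → X),
      gain k s2 q b x = postCov k s2 q b x ^ 2 / (postVar k s2 q b + s2 b) := fun q => by
    rw [gain, ← postCov_self (Fin.snoc _ _), postCov_snoc hK hs, postCov_self]; ring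
  have hV := postVar_nonneg hK hs p b
  have hs' : (0 : ℝ) < s2 b := by exact_mod_cast hs b
  have e1 := postCov_snoc hK hs p b b b
  have e2 := postCov_snoc hK hs p b b x
  rw [postCov_self, postCov_self] at e1
  rw [postCov_self] at e2
  rw [hgain, hgain, e1, e2]
  set V := postVar k s2 p b
  set C := postCov k s2 p b x
  have hVs : 0 < V + s2 b := by positivity
  have h1 : C - V * C / (V + s2 b) = C * (s2 b / (V + s2 b)) := by field_simp; ring
  have h2 : V - V * V / (V + s2 b) + s2 b = s2 b * ((2 * V + s2 b) / (V + s2 b)) := by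
    field_simp; ring
  rw [h1, h2]
  have h3 : (C * (s2 b / (V + s2 b))) ^ 2 / (s2 b * ((2 * V + s2 b) / (V + s2 b)))
      = C ^ 2 / (V + s2 b) * (s2 b / (2 * V + s2 b)) := by
    field_simp
  rw [h3]
  refine mul_le_of_le_one_right (by positivity) ?_
  rw [div_le_one (by positivity)]
  linarith

theorem postVar_append_le (hK : (Matrix.of k).PosSemidef) (hs : ∀ x, 0 < s2 x)
    (p : Fin t → X) {n : ℕ} (S : Fin n → X) (x : X) :
    postVar k s2 (Fin.append p S) x ≤ postVar k s2 S x := by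
  have h := postVar_le_postVar_comp hK hs (Fin.append p S) (Fin.natAdd_injective n t) x
  rwa [show Fin.append p S ∘ Fin.natAdd t = S from funext (Fin.append_right p S)] at h

variable [DecidableEq X]

/-- Diminishing returns. For `a ≠ b` this is submodularity on the sets `{a}` and `{b}`; repeated
points are not covered by submodularity on sets. -/
theorem gain_snoc_le (hK : (Matrix.of k).PosSemidef) (hs : ∀ x, 0 < s2 x)
    (hsub : SubmodularVarianceReduction k s2) (p : Fin t → X) (a b x : X) :
    gain k s2 (Fin.snoc (α := fun _ => X) p a) b x ≤ gain k s2 p b x := by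
  rcases eq_or_ne a b with rfl | hab
  · exact gain_snoc_self_le hK hs p a x
  have h := hsub t p x {a} {b}
  have h0 : postVar k s2 (Sum.elim p (fun s : (∅ : Finset X) => (s : X))) x
      = postVar k s2 p x :=
    (postVar_comp_bijective hK hs _ (f := Sum.inl)
      ⟨Sum.inl_injective, by rintro (i | ⟨y, hy⟩); exacts [⟨i, rfl⟩, by simp at hy]⟩ x).symm
  have h1 : ∀ c : X, postVar k s2 (Sum.elim p (fun s : ({c} : Finset X) => (s : X))) x
      = postVar k s2 (Fin.snoc (α := fun _ => X) p c) x := fun c => by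
    have hf : Function.Bijective (Fin.snoc (α := fun _ => Fin t ⊕ ({c} : Finset X)) Sum.inl
        (Sum.inr ⟨c, by simp⟩)) := by
      rw [Fintype.bijective_iff_injective_and_card]
      refine ⟨?_, by simp⟩
      rw [Fin.snoc_injective_iff]
      exact ⟨Sum.inl_injective, by simp⟩
    rw [← postVar_comp_bijective hK hs _ hf, Fin.comp_snoc, Sum.elim_comp_inl]
    rfl
  have h2 : postVar k s2 (Sum.elim p (fun s : ({a} ∪ {b} : Finset X) => (s : X))) x
      = postVar k s2 (Fin.snoc (α := fun _ => X) (Fin.snoc (α := fun _ => X) p a) b) x := by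
    have hf : Function.Bijective (Fin.snoc (α := fun _ => Fin t ⊕ ({a} ∪ {b} : Finset X))
        (Fin.snoc (α := fun _ => Fin t ⊕ ({a} ∪ {b} : Finset X)) Sum.inl
          (Sum.inr ⟨a, by simp⟩)) (Sum.inr ⟨b, by simp⟩)) := by
      rw [Fintype.bijective_iff_injective_and_card]
      refine ⟨?_, by rw [Fintype.card_sum, Fintype.card_coe, Fintype.card_fin, Fintype.card_fin,
        Finset.card_union_of_disjoint (Finset.disjoint_singleton.2 hab)]; rfl⟩
      rw [Fin.snoc_injective_iff, Fin.snoc_injective_iff]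
      refine ⟨⟨Sum.inl_injective, by rintro ⟨i, hi⟩; cases hi⟩, ?_⟩
      rintro ⟨i, hi⟩
      revert hi
      refine Fin.lastCases ?_ (fun i => ?_) i <;> simp [hab]
    rw [← postVar_comp_bijective hK hs _ hf, Fin.comp_snoc, Fin.comp_snoc, Sum.elim_comp_inl]
    rfl
  have hint : ({a} ∩ {b} : Finset X) = ∅ := by simp [hab]
  rw [hint] at h
  simp only [h0, h1, h2] at h
  unfold gain
  linarith

theorem gain_append_le (hK : (Matrix.of k).PosSemidef) (hs : ∀ x, 0 < s2 x)
    (hsub : SubmodularVarianceReduction k s2) (p : Fin t → X) {n : ℕ} (S : Fin n → X) (b x : X) :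
    gain k s2 (Fin.append p S) b x ≤ gain k s2 p b x := by
  induction n with
  | zero => simp [Fin.append_right_nil]
  | succ n ih =>
    rw [← Fin.snoc_init_self S, Fin.append_snoc]
    exact (gain_snoc_le hK hs hsub _ _ b x).trans (ih _)

/-- The joint variance reduction of a family, repetitions allowed, is at most the sum of the single
reductions. -/
theorem postVar_sub_append_le (hK : (Matrix.of k).PosSemidef) (hs : ∀ x, 0 < s2 x)
    (hsub : SubmodularVarianceReduction k s2) (p : Fin t → X) {n : ℕ} (S : Fin n → X) (x : X) :
    postVar k s2 p x - postVar k s2 (Fin.append p S) x ≤ ∑ j, gain k s2 p (S j) x := by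
  induction n with
  | zero => simp [Fin.append_right_nil]
  | succ n ih =>
    rw [← Fin.snoc_init_self S, Fin.append_snoc, Fin.sum_univ_castSucc]
    simp only [Fin.snoc_castSucc, Fin.snoc_last]
    have h1 := ih (Fin.init S)
    have h2 := gain_append_le hK hs hsub p (Fin.init S) (S (Fin.last n)) x
    rw [gain] at h2
    linarith

end Update

/-! ### Greedy reduction of the excess variance -/

/-- The inputs for which the algorithm is analysed. -/
structure Config.Admissible {X : Type*} [DecidableEq X] (cfg : Config X) : Prop where
  cost_pos : ∀ x, 0 < cfg.cost x
  noise_pos : ∀ x, 0 < cfg.noiseVar x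
  slack_pos : 0 < cfg.slack
  r_pos : 0 < cfg.r
  r_lt_one : cfg.r < 1
  eta1_pos : 0 < cfg.eta1
  rel_nonneg : 0 ≤ cfg.εrel
  beta_mono : MonotoneOn cfg.β (Set.Ici 1)
  posSemidef : (Matrix.of cfg.k).PosSemidef
  prior_le_one : ∀ x, cfg.k x x ≤ 1
  submodular : SubmodularVarianceReduction cfg.k cfg.noiseVar

/-- If observing all points of a family brings `a v` below `e`, then the reductions of the truncated
excess by the single points add up to at least the whole excess. -/
theorem max_excess_le_sum {n : ℕ} {a e v vS : ℝ} {w : Fin n → ℝ} (ha : 0 ≤ a)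
    (hw : ∀ j, w j ≤ v) (hsum : v - vS ≤ ∑ j, (v - w j)) (hS : a * vS ≤ e) :
    max (a * v - e) 0 ≤ ∑ j, (max (a * v - e) 0 - max (a * w j - e) 0) := by
  have hmono : ∀ j, 0 ≤ max (a * v - e) 0 - max (a * w j - e) 0 := fun j =>
    sub_nonneg.2 (max_le_max_right _ (by have := mul_le_mul_of_nonneg_left (hw j) ha; linarith))
  rcases le_or_gt (a * v - e) 0 with h0 | h0
  · rw [max_eq_right h0] at hmono ⊢
    exact Finset.sum_nonneg fun j _ => hmono j
  by_cases h : ∃ j, a * w j - e ≤ 0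
  · obtain ⟨j, hj⟩ := h
    refine le_trans ?_ (Finset.single_le_sum (fun j _ => hmono j) (Finset.mem_univ j))
    rw [max_eq_right hj, sub_zero]
  · push Not at h
    simp only [max_eq_left h0.le, fun j => max_eq_left (h j).le]
    calc a * v - e ≤ a * (v - vS) := by linarith
      _ ≤ a * ∑ j, (v - w j) := mul_le_mul_of_nonneg_left hsum ha
      _ = _ := by rw [Finset.mul_sum]; exact Finset.sum_congr rfl fun j _ => by ring

namespace Config

variable {X : Type*} (cfg : Config X)

/-- The excess variance that the acquisition function reduces: that of the unclassified points `U`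
plus that of the potential minimizers `M`. -/
noncomputable def potential (i : ℕ) (U M : Finset X) {t : ℕ} (p : Fin t → X) : ℝ :=
  cfg.excess i U (postVar cfg.k cfg.noiseVar p) 1
    + cfg.excess i M (postVar cfg.k cfg.noiseVar p) (1 + cfg.εrel)

theorem acquisition_eq {t : ℕ} (s : State X t) (x : X) :
    cfg.acquisition s x = (cfg.potential s.epoch s.U s.M s.pts
      - cfg.potential s.epoch s.U s.M (Fin.snoc (α := fun _ => X) s.pts x)) / cfg.cost x := by
  simp only [acquisition, potential]
  congr 1
  ring

theorem excess_nonneg (i : ℕ) (D : Finset X) (v : X → ℝ) (p : ℝ) : 0 ≤ cfg.excess i D v p :=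
  Finset.sum_nonneg fun _ _ => le_max_right _ _

theorem excess_mono_set (i : ℕ) {D D' : Finset X} (h : D ⊆ D') (v : X → ℝ) (p : ℝ) :
    cfg.excess i D v p ≤ cfg.excess i D' v p :=
  Finset.sum_le_sum_of_subset_of_nonneg h fun _ _ _ => le_max_right _ _

theorem potential_nonneg (i : ℕ) (U M : Finset X) {t : ℕ} (p : Fin t → X) :
    0 ≤ cfg.potential i U M p :=
  add_nonneg (cfg.excess_nonneg _ _ _ _) (cfg.excess_nonneg _ _ _ _)

theorem potential_mono_set (i : ℕ) {U U' M M' : Finset X} (hU : U ⊆ U') (hM : M ⊆ M') {t : ℕ}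
    (p : Fin t → X) : cfg.potential i U M p ≤ cfg.potential i U' M' p :=
  add_le_add (cfg.excess_mono_set _ hU _ _) (cfg.excess_mono_set _ hM _ _)

variable {cfg} [DecidableEq X]

theorem Admissible.eta_pos (hA : cfg.Admissible) (i : ℕ) : 0 < cfg.η i :=
  mul_pos hA.eta1_pos (pow_pos hA.r_pos _)

theorem Admissible.eta_anti (hA : cfg.Admissible) : Antitone cfg.η := fun _ _ h =>
  mul_le_mul_of_nonneg_left
    (pow_le_pow_of_le_one hA.r_pos.le hA.r_lt_one.le (Nat.sub_le_sub_right h 1)) hA.eta1_pos.le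

theorem Admissible.tendsto_eta (hA : cfg.Admissible) :
    Filter.Tendsto cfg.η Filter.atTop (nhds 0) := by
  have h := (tendsto_pow_atTop_nhds_zero_of_lt_one hA.r_pos.le hA.r_lt_one).const_mul cfg.eta1
  rw [mul_zero] at h
  exact h.comp (Filter.tendsto_sub_atTop_nat 1)

theorem Admissible.one_add_rel_pos (hA : cfg.Admissible) : 0 < 1 + cfg.εrel := by
  have := hA.rel_nonneg; linarith

theorem excess_le_sum (hA : cfg.Admissible) {i : ℕ} (hβ : 0 ≤ cfg.β i) (D : Finset X) (q : ℝ)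
    {t n : ℕ} (p : Fin t → X) (S : Fin n → X)
    (hS : ∀ x ∈ D, q ^ 2 * cfg.β i * postVar cfg.k cfg.noiseVar S x ≤ cfg.η i ^ 2) :
    cfg.excess i D (postVar cfg.k cfg.noiseVar p) q
      ≤ ∑ j, (cfg.excess i D (postVar cfg.k cfg.noiseVar p) q
        - cfg.excess i D
            (postVar cfg.k cfg.noiseVar (Fin.snoc (α := fun _ => X) p (S j))) q) := by
  simp only [excess, ← Finset.sum_sub_distrib]
  rw [Finset.sum_comm]
  refine Finset.sum_le_sum fun x hx => ?_
  refine max_excess_le_sum (by positivity)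
    (fun j => sub_nonneg.1 (gain_nonneg hA.posSemidef hA.noise_pos p (S j) x))
    (postVar_sub_append_le hA.posSemidef hA.noise_pos hA.submodular p S x) ?_
  exact (mul_le_mul_of_nonneg_left (postVar_append_le hA.posSemidef hA.noise_pos p S x)
    (by positivity)).trans (hS x hx)

theorem potential_snoc_le (hA : cfg.Admissible) {i : ℕ} (hβ : 0 ≤ cfg.β i) (U M : Finset X) {t : ℕ}
    (p : Fin t → X) (b : X) :
    cfg.potential i U M (Fin.snoc (α := fun _ => X) p b) ≤ cfg.potential i U M p := by
  have h : ∀ (D : Finset X) (q : ℝ), cfg.excess i D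
      (postVar cfg.k cfg.noiseVar (Fin.snoc (α := fun _ => X) p b)) q
      ≤ cfg.excess i D (postVar cfg.k cfg.noiseVar p) q := fun D q =>
    Finset.sum_le_sum fun x _ => max_le_max_right _ <| sub_le_sub_right
      (mul_le_mul_of_nonneg_left
        (sub_nonneg.1 (gain_nonneg hA.posSemidef hA.noise_pos p b x)) (by positivity)) _
  exact add_le_add (h _ _) (h _ _)

/-- One greedy step shrinks the potential by the factor `1 - cost / B`, where `B` bounds the cost of
some family whose observation makes the potential vanish. -/
theorem potential_greedy (hA : cfg.Admissible) {t : ℕ} (s : State X t) (hβ : 0 ≤ cfg.β s.epoch)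
    {n : ℕ} (S : Fin n → X) {B : ℝ} (hB : 0 < B) (hSB : ∑ j, cfg.cost (S j) ≤ B)
    (hU : ∀ x ∈ s.U, cfg.β s.epoch * postVar cfg.k cfg.noiseVar S x ≤ cfg.η s.epoch ^ 2)
    (hM : ∀ x ∈ s.M, (1 + cfg.εrel) ^ 2 * cfg.β s.epoch * postVar cfg.k cfg.noiseVar S x
      ≤ cfg.η s.epoch ^ 2)
    {b : X} (hb : ∀ x, cfg.acquisition s x ≤ cfg.acquisition s b) :
    cfg.potential s.epoch s.U s.M (Fin.snoc (α := fun _ => X) s.pts b)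
      ≤ (1 - cfg.cost b / B) * cfg.potential s.epoch s.U s.M s.pts := by
  set Δ := cfg.potential s.epoch s.U s.M s.pts with hΔ
  have hacq : ∀ x, Δ - cfg.potential s.epoch s.U s.M (Fin.snoc (α := fun _ => X) s.pts x)
      = cfg.acquisition s x * cfg.cost x := fun x => by
    rw [acquisition_eq, div_mul_cancel₀ _ (hA.cost_pos x).ne']
  have h1 : Δ ≤ ∑ j, (Δ - cfg.potential s.epoch s.U s.M
      (Fin.snoc (α := fun _ => X) s.pts (S j))) := by
    have e1 := excess_le_sum hA hβ s.U 1 s.pts S (by simpa using hU)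
    have e2 := excess_le_sum hA hβ s.M (1 + cfg.εrel) s.pts S hM
    refine (add_le_add e1 e2).trans_eq ?_
    rw [← Finset.sum_add_distrib]
    exact Finset.sum_congr rfl fun j _ => by simp only [hΔ, potential]; ring
  have hacq0 : 0 ≤ cfg.acquisition s b := by
    rw [acquisition_eq]
    exact div_nonneg (sub_nonneg.2 (potential_snoc_le hA hβ _ _ _ _)) (hA.cost_pos b).le
  have h2 : Δ ≤ cfg.acquisition s b * B := by
    refine h1.trans (le_trans ?_ (mul_le_mul_of_nonneg_left hSB hacq0))
    rw [Finset.mul_sum]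
    refine Finset.sum_le_sum fun j _ => ?_
    rw [hacq]
    exact mul_le_mul_of_nonneg_right (hb _) (hA.cost_pos _).le
  have h3 : cfg.cost b / B * Δ ≤ cfg.acquisition s b * cfg.cost b := by
    calc cfg.cost b / B * Δ ≤ cfg.cost b / B * (cfg.acquisition s b * B) :=
          mul_le_mul_of_nonneg_left h2 (div_nonneg (hA.cost_pos b).le hB.le)
      _ = cfg.acquisition s b * cfg.cost b := by field_simp
  have := hacq b
  linarith

theorem excess_le_card (hA : cfg.Admissible) {i : ℕ} (hβ : 0 ≤ cfg.β i) (D : Finset X) (q : ℝ)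
    {t : ℕ} (p : Fin t → X) :
    cfg.excess i D (postVar cfg.k cfg.noiseVar p) q ≤ q ^ 2 * cfg.β i * D.card := by
  rw [mul_comm, ← nsmul_eq_mul]
  refine Finset.sum_le_card_nsmul _ _ _ fun x _ => max_le ?_ (by positivity)
  have h1 := (postVar_le_prior hA.posSemidef hA.noise_pos p x).trans (hA.prior_le_one x)
  have h2 : q ^ 2 * cfg.β i * postVar cfg.k cfg.noiseVar p x ≤ q ^ 2 * cfg.β i * 1 :=
    mul_le_mul_of_nonneg_left h1 (by positivity)
  have := sq_nonneg (cfg.η i)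
  linarith

theorem potential_le_card (hA : cfg.Admissible) {i : ℕ} (hβ : 0 ≤ cfg.β i) (U M : Finset X)
    {t : ℕ} (p : Fin t → X) :
    cfg.potential i U M p ≤ cfg.β i * (U.card + (1 + cfg.εrel) ^ 2 * M.card) := by
  have h1 := excess_le_card hA hβ U 1 p
  have h2 := excess_le_card hA hβ M (1 + cfg.εrel) p
  unfold potential
  linarith

/-- While the epoch is not done, the excess variance stays above `δ̄² η²`. -/
theorem lt_potential_of_not_epochDone (hA : cfg.Admissible) {i : ℕ} (hβ : 0 ≤ cfg.β i)
    {U M : Finset X} {t : ℕ} {p : Fin t → X} (h : ¬ cfg.epochDone p U M i) :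
    cfg.slack ^ 2 * cfg.η i ^ 2 < cfg.potential i U M p := by
  have hη := hA.eta_pos i
  have hδ := hA.slack_pos
  have key : ∀ (D : Finset X) (q : ℝ), ∀ x ∈ D,
      (1 + cfg.slack) * cfg.η i < q * (√(cfg.β i) * postStd cfg.k cfg.noiseVar p x) →
      cfg.slack ^ 2 * cfg.η i ^ 2 < cfg.excess i D (postVar cfg.k cfg.noiseVar p) q := by
    intro D q x hx hlt
    refine lt_of_lt_of_le ?_ (Finset.single_le_sum (f := fun x => max (q ^ 2 * cfg.β i *
      postVar cfg.k cfg.noiseVar p x - cfg.η i ^ 2) 0) (fun _ _ => le_max_right _ _) hx)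
    refine lt_max_of_lt_left ?_
    have hsq : ((1 + cfg.slack) * cfg.η i) ^ 2
        < (q * (√(cfg.β i) * postStd cfg.k cfg.noiseVar p x)) ^ 2 :=
      pow_lt_pow_left₀ hlt (by positivity) two_ne_zero
    rw [mul_pow q, mul_pow (√_), postStd, Real.sq_sqrt hβ,
      Real.sq_sqrt (postVar_nonneg hA.posSemidef hA.noise_pos p x)] at hsq
    have : 0 < cfg.slack * cfg.η i ^ 2 := by positivity
    nlinarith
  rw [epochDone, not_and_or] at h
  rcases h with h | h
  · push Not at h
    obtain ⟨x, hx, hlt⟩ := h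
    refine (key U 1 x hx (by rwa [one_mul])).trans_le ?_
    exact le_add_of_nonneg_right (cfg.excess_nonneg _ _ _ _)
  · push Not at h
    obtain ⟨x, hx, hlt⟩ := h
    refine (key M (1 + cfg.εrel) x hx ?_).trans_le ?_
    · have h1 := hA.one_add_rel_pos
      rw [div_mul_eq_mul_div, div_lt_iff₀ h1] at hlt
      linarith
    · exact le_add_of_nonneg_left (cfg.excess_nonneg _ _ _ _)

/-! ### The covering cost -/

theorem coverCost_nonneg (hA : cfg.Admissible) (a b : ℝ) (U M : Finset X) :
    0 ≤ cfg.coverCost a b U M := by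
  refine Real.sInf_nonneg ?_
  rintro _ ⟨n, S, rfl, -⟩
  exact Finset.sum_nonneg fun j _ => (hA.cost_pos _).le

/-- Some family covers: observe every point sufficiently often. Otherwise `coverCost` would be the
infimum of the empty set. -/
theorem exists_cover [Fintype X] (hA : cfg.Admissible) {a : ℝ} (ha : 0 < a) :
    ∃ (n : ℕ) (S : Fin n → X), ∀ x, postStd cfg.k cfg.noiseVar S x ≤ a := by
  obtain ⟨n, hn⟩ : ∃ n : ℕ, ∀ x, (cfg.noiseVar x : ℝ) / a ^ 2 < n := by
    obtain ⟨n, hn⟩ := exists_nat_gt (∑ x, (cfg.noiseVar x : ℝ) / a ^ 2)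
    refine ⟨n, fun x => lt_of_le_of_lt ?_ hn⟩
    exact Finset.single_le_sum (f := fun x => (cfg.noiseVar x : ℝ) / a ^ 2)
      (fun x _ => by positivity) (Finset.mem_univ x)
  let e := Fintype.equivFin (Fin n × X)
  refine ⟨_, fun j => (e.symm j).2, fun x => ?_⟩
  have hn0 : 0 < n := by
    have h1 := hn x
    have h2 : (0 : ℝ) ≤ (cfg.noiseVar x : ℝ) / a ^ 2 := by positivity
    exact_mod_cast h2.trans_lt h1
  refine Real.sqrt_le_iff.2 ⟨ha.le, ?_⟩
  refine (postVar_le_of_repeated hA.posSemidef hA.noise_pos (fun j => (e.symm j).2) hn0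
    (f := fun i => e (i, x)) (x := x) (fun i j h => by simpa using h) (fun i => by simp)).trans ?_
  have h1 := hn x
  rw [div_lt_iff₀ (by positivity)] at h1
  rw [div_le_iff₀ (by positivity)]
  linarith

/-- A family of cost below `B` that covers, for every `B` above the covering cost. -/
theorem exists_cover_lt [Fintype X] (hA : cfg.Admissible) {i : ℕ} (hβ : 0 < cfg.β i)
    (U M : Finset X) {B : ℝ}
    (hB : cfg.coverCost (cfg.η i / √(cfg.β i)) (cfg.η i / (√(cfg.β i) * (1 + cfg.εrel))) U M < B) :
    ∃ (n : ℕ) (S : Fin n → X), ∑ j, cfg.cost (S j) < B ∧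
      (∀ x ∈ U, cfg.β i * postVar cfg.k cfg.noiseVar S x ≤ cfg.η i ^ 2) ∧
      (∀ x ∈ M, (1 + cfg.εrel) ^ 2 * cfg.β i * postVar cfg.k cfg.noiseVar S x
        ≤ cfg.η i ^ 2) := by
  have hη := hA.eta_pos i
  have hrel := hA.one_add_rel_pos
  have hsβ := Real.sqrt_pos.2 hβ
  have hne : {B | ∃ (n : ℕ) (S : Fin n → X), B = ∑ j, cfg.cost (S j) ∧
      (∀ x ∈ U, postStd cfg.k cfg.noiseVar S x ≤ cfg.η i / √(cfg.β i)) ∧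
      (∀ x ∈ M, postStd cfg.k cfg.noiseVar S x
        ≤ cfg.η i / (√(cfg.β i) * (1 + cfg.εrel)))}.Nonempty := by
    obtain ⟨n, S, hS⟩ := exists_cover hA (a := min (cfg.η i / √(cfg.β i))
      (cfg.η i / (√(cfg.β i) * (1 + cfg.εrel)))) (lt_min (by positivity) (by positivity))
    exact ⟨_, n, S, rfl, fun x _ => (hS x).trans (min_le_left _ _),
      fun x _ => (hS x).trans (min_le_right _ _)⟩
  obtain ⟨_, ⟨n, S, rfl, hU, hM⟩, hlt⟩ := exists_lt_of_csInf_lt hne hB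
  have key : ∀ (q : ℝ), 0 < q → ∀ x, postStd cfg.k cfg.noiseVar S x ≤ cfg.η i / q →
      q ^ 2 * postVar cfg.k cfg.noiseVar S x ≤ cfg.η i ^ 2 := by
    intro q hq x hx
    rw [postStd, le_div_iff₀ hq] at hx
    have h := pow_le_pow_left₀ (by positivity) hx 2
    rw [mul_pow, Real.sq_sqrt (postVar_nonneg hA.posSemidef hA.noise_pos S x)] at h
    linarith
  refine ⟨n, S, hlt, fun x hx => ?_, fun x hx => ?_⟩
  · simpa [Real.sq_sqrt hβ.le] using key _ hsβ x (hU x hx)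
  · have := key _ (by positivity) x (hM x hx)
    rwa [mul_pow, Real.sq_sqrt hβ.le, mul_comm (cfg.β i)] at this

end Config

/-! ### One iteration of the algorithm -/

theorem iInf_coe_le {X : Type*} {D : Finset X} (f : X → ℝ) {x : X} (hx : x ∈ D) :
    ⨅ y : D, f y ≤ f x :=
  ciInf_le (Set.finite_range fun y : D => f y).bddBelow (⟨x, hx⟩ : D)

theorem exists_eq_iInf_coe {X : Type*} {D : Finset X} (hD : D.Nonempty) (f : X → ℝ) :
    ∃ x ∈ D, f x = ⨅ y : D, f y := by
  have : Nonempty D := hD.coe_sort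
  obtain ⟨⟨x, hx⟩, h⟩ := exists_eq_ciInf_of_finite (f := fun y : D => f y)
  exact ⟨x, hx, h⟩

namespace Config

theorem nextEpoch_spec {X : Type*} {cfg : Config X} {t : ℕ} {p : Fin t → X} {U M : Finset X} {i : ℕ}
    (h : ∃ j, i ≤ j ∧ ¬ cfg.epochDone p U M j) :
    i ≤ cfg.nextEpoch p U M i ∧ ¬ cfg.epochDone p U M (cfg.nextEpoch p U M i) ∧
      ∀ j, i ≤ j → j < cfg.nextEpoch p U M i → cfg.epochDone p U M j := by
  obtain ⟨h1, h2⟩ := Nat.sInf_mem (s := {j | i ≤ j ∧ ¬ cfg.epochDone p U M j}) h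
  refine ⟨h1, h2, fun j hj hlt => ?_⟩
  by_contra hd
  exact Nat.notMem_of_lt_sInf hlt ⟨hj, hd⟩

variable {X : Type*} [Fintype X] {cfg : Config X} {pick : Finset X → X} {y : X → ℝ} {t : ℕ}
  {s : State X t}

variable (cfg pick y s) in
/-- Lower confidence bounds `l` of the iteration that starts in the state `s`. -/
noncomputable def stepLower : X → ℝ :=
  cfg.lower s.epoch (cfg.step pick y s).pts (cfg.step pick y s).obs

variable (cfg pick y s) in
/-- Upper confidence bounds `u` of the iteration that starts in the state `s`. -/
noncomputable def stepUpper : X → ℝ :=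
  cfg.upper s.epoch (cfg.step pick y s).pts (cfg.step pick y s).obs

theorem mem_step_U {x : X} : x ∈ (cfg.step pick y s).U ↔ x ∈ s.U ∧
    ¬ cfg.stepUpper pick y s x ≤ (⨅ z : s.M, cfg.stepLower pick y s z) * (1 + cfg.εrel) + cfg.εabs ∧
    ¬ (⨅ z : s.M, cfg.stepUpper pick y s z) * (1 + cfg.εrel) + cfg.εabs
      < cfg.stepLower pick y s x :=
  Finset.mem_filter

theorem mem_step_M {x : X} : x ∈ (cfg.step pick y s).M ↔ x ∈ s.M ∧
    cfg.stepLower pick y s x ≤ ⨅ z : s.M, cfg.stepUpper pick y s z :=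
  Finset.mem_filter

theorem mem_step_L {x : X} : x ∈ (cfg.step pick y s).L ↔ x ∈ s.L ∨ (x ∈ s.U ∧
    cfg.stepUpper pick y s x
      ≤ (⨅ z : s.M, cfg.stepLower pick y s z) * (1 + cfg.εrel) + cfg.εabs) := by
  classical
  exact Finset.mem_union.trans (or_congr_right Finset.mem_filter)

theorem mem_step_H {x : X} : x ∈ (cfg.step pick y s).H ↔ x ∈ s.H ∨ (x ∈ s.U ∧
    ¬ cfg.stepUpper pick y s x ≤ (⨅ z : s.M, cfg.stepLower pick y s z) * (1 + cfg.εrel) + cfg.εabs ∧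
    (⨅ z : s.M, cfg.stepUpper pick y s z) * (1 + cfg.εrel) + cfg.εabs
      < cfg.stepLower pick y s x) := by
  classical
  exact Finset.mem_union.trans (or_congr_right Finset.mem_filter)

theorem stepLower_le_stepUpper (x : X) : cfg.stepLower pick y s x ≤ cfg.stepUpper pick y s x := by
  have : 0 ≤ √(cfg.β s.epoch) * postStd cfg.k cfg.noiseVar (cfg.step pick y s).pts x :=
    mul_nonneg (Real.sqrt_nonneg _) (Real.sqrt_nonneg _)
  simp only [stepLower, stepUpper, lower, upper]
  linarith

/-- The point with the least lower bound always stays a potential minimizer. -/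
theorem step_M_nonempty (h : s.M.Nonempty) : (cfg.step pick y s).M.Nonempty := by
  obtain ⟨x, hx, hxl⟩ := exists_eq_iInf_coe h (cfg.stepLower pick y s)
  obtain ⟨z, hz, hzu⟩ := exists_eq_iInf_coe h (cfg.stepUpper pick y s)
  refine ⟨x, mem_step_M.2 ⟨hx, ?_⟩⟩
  rw [hxl, ← hzu]
  exact (iInf_coe_le _ hz).trans (stepLower_le_stepUpper z)

theorem totalCost_step : cfg.totalCost (cfg.step pick y s)
    = cfg.totalCost s + cfg.cost (pick (cfg.argmaxSet s)) := by
  simp only [totalCost, step, Fin.sum_univ_castSucc, Fin.snoc_castSucc, Fin.snoc_last]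

theorem step_minimizer {c : X → ℝ}
    (hv : ∀ x, cfg.stepLower pick y s x ≤ c x ∧ c x ≤ cfg.stepUpper pick y s x)
    (hmin : ∃ x ∈ s.M, c x = ⨅ z, c z) : ∃ x ∈ (cfg.step pick y s).M, c x = ⨅ z, c z := by
  obtain ⟨x, hx, hxc⟩ := hmin
  obtain ⟨z, hz, hzu⟩ := exists_eq_iInf_coe ⟨x, hx⟩ (cfg.stepUpper pick y s)
  refine ⟨x, mem_step_M.2 ⟨hx, ?_⟩, hxc⟩
  rw [← hzu]
  refine (hv x).1.trans (le_trans ?_ (hv z).2)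
  rw [hxc]
  exact ciInf_le (Set.finite_range c).bddBelow z

/-- The pessimistic estimate of the minimum is at least the minimum, so `h ≤ h^pes`. -/
theorem iInf_le_iInf_stepUpper {c : X → ℝ}
    (hv : ∀ x, cfg.stepLower pick y s x ≤ c x ∧ c x ≤ cfg.stepUpper pick y s x)
    (hmin : ∃ x ∈ s.M, c x = ⨅ z, c z) : ⨅ z, c z ≤ ⨅ z : s.M, cfg.stepUpper pick y s z := by
  obtain ⟨x, hx, hxc⟩ := hmin
  obtain ⟨z, hz, hzu⟩ := exists_eq_iInf_coe ⟨x, hx⟩ (cfg.stepUpper pick y s)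
  rw [← hzu]
  exact (ciInf_le (Set.finite_range c).bddBelow z).trans (hv z).2

/-- The optimistic estimate of the minimum is at most the minimum, so `h^opt ≤ h`. -/
theorem iInf_stepLower_le_iInf {c : X → ℝ}
    (hv : ∀ x, cfg.stepLower pick y s x ≤ c x ∧ c x ≤ cfg.stepUpper pick y s x)
    (hmin : ∃ x ∈ s.M, c x = ⨅ z, c z) : ⨅ z : s.M, cfg.stepLower pick y s z ≤ ⨅ z, c z := by
  obtain ⟨x, hx, hxc⟩ := hmin
  exact (iInf_coe_le _ hx).trans ((hv x).1.trans_eq hxc)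

theorem le_threshold_of_mem_step_L (hrel : 0 ≤ 1 + cfg.εrel) {c : X → ℝ}
    (hv : ∀ x, cfg.stepLower pick y s x ≤ c x ∧ c x ≤ cfg.stepUpper pick y s x)
    (hmin : ∃ x ∈ s.M, c x = ⨅ z, c z) (hL : ∀ x ∈ s.L, c x ≤ cfg.threshold c) :
    ∀ x ∈ (cfg.step pick y s).L, c x ≤ cfg.threshold c := by
  intro x hx
  rcases mem_step_L.1 hx with h | ⟨-, h⟩
  · exact hL x h
  · exact (hv x).2.trans (h.trans (add_le_add_left
      (mul_le_mul_of_nonneg_right (iInf_stepLower_le_iInf hv hmin) hrel) _))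

theorem threshold_lt_of_mem_step_H (hrel : 0 ≤ 1 + cfg.εrel) {c : X → ℝ}
    (hv : ∀ x, cfg.stepLower pick y s x ≤ c x ∧ c x ≤ cfg.stepUpper pick y s x)
    (hmin : ∃ x ∈ s.M, c x = ⨅ z, c z) (hH : ∀ x ∈ s.H, cfg.threshold c < c x) :
    ∀ x ∈ (cfg.step pick y s).H, cfg.threshold c < c x := by
  intro x hx
  rcases mem_step_H.1 hx with h | ⟨-, -, h⟩
  · exact hH x h
  · refine lt_of_le_of_lt ?_ (h.trans_le (hv x).1)
    exact add_le_add_left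
      (mul_le_mul_of_nonneg_right (iInf_le_iInf_stepUpper hv hmin) hrel) _

/-- The points that survive an iteration with confidence half-widths at most `w` on `U` and
`w / (1 + ε_rel)` on `M` are close to the threshold, respectively to the minimum. -/
theorem step_hard (hrel : 0 < 1 + cfg.εrel) {c : X → ℝ}
    (hv : ∀ x, cfg.stepLower pick y s x ≤ c x ∧ c x ≤ cfg.stepUpper pick y s x)
    (hmin : ∃ x ∈ s.M, c x = ⨅ z, c z) {w : ℝ}
    (hU : ∀ x ∈ (cfg.step pick y s).U,
      √(cfg.β s.epoch) * postStd cfg.k cfg.noiseVar (cfg.step pick y s).pts x ≤ w)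
    (hM : ∀ x ∈ (cfg.step pick y s).M,
      √(cfg.β s.epoch) * postStd cfg.k cfg.noiseVar (cfg.step pick y s).pts x
        ≤ w / (1 + cfg.εrel)) :
    (∀ x ∈ (cfg.step pick y s).U, |c x - cfg.threshold c| ≤ 4 * w) ∧
    (∀ x ∈ (cfg.step pick y s).M, c x ≤ (⨅ z, c z) + 4 * (w / (1 + cfg.εrel))) := by
  have hwidth : ∀ x, cfg.stepUpper pick y s x = cfg.stepLower pick y s x
      + 2 * (√(cfg.β s.epoch) * postStd cfg.k cfg.noiseVar (cfg.step pick y s).pts x) := fun x => by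
    simp only [stepLower, stepUpper, lower, upper]; ring
  obtain ⟨x₀, hx₀, hx₀c⟩ := step_minimizer hv hmin
  have hx₀M := (mem_step_M.1 hx₀).1
  have hpes : (⨅ z : s.M, cfg.stepUpper pick y s z) ≤ (⨅ z, c z) + 2 * (w / (1 + cfg.εrel)) := by
    refine (iInf_coe_le _ hx₀M).trans ?_
    have h1 := hwidth x₀
    have h2 := hM x₀ hx₀
    have h3 := (hv x₀).1
    linarith
  have hopt : (⨅ z, c z) - 2 * (w / (1 + cfg.εrel)) ≤ ⨅ z : s.M, cfg.stepLower pick y s z := by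
    obtain ⟨x₁, hx₁, hx₁l⟩ := exists_eq_iInf_coe ⟨x₀, hx₀M⟩ (cfg.stepLower pick y s)
    have hx₁M : x₁ ∈ (cfg.step pick y s).M := by
      refine mem_step_M.2 ⟨hx₁, ?_⟩
      rw [hx₁l]
      exact (iInf_stepLower_le_iInf hv hmin).trans (iInf_le_iInf_stepUpper hv hmin)
    have h1 := hwidth x₁
    have h2 := hM x₁ hx₁M
    have h3 := (hv x₁).2
    have h4 : ⨅ z, c z ≤ c x₁ := ciInf_le (Set.finite_range c).bddBelow x₁
    rw [← hx₁l]
    linarith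
  have hw : w / (1 + cfg.εrel) * (1 + cfg.εrel) = w := div_mul_cancel₀ _ hrel.ne'
  have hpes' := mul_le_mul_of_nonneg_right hpes hrel.le
  have hopt' := mul_le_mul_of_nonneg_right hopt hrel.le
  rw [add_mul, mul_assoc, hw] at hpes'
  rw [sub_mul, mul_assoc, hw] at hopt'
  refine ⟨fun x hx => ?_, fun x hx => ?_⟩
  · obtain ⟨-, h1, h2⟩ := mem_step_U.1 hx
    have h3 := hwidth x
    have h4 := hU x hx
    have h5 := hv x
    rw [abs_le, threshold]
    constructor <;> linarith
  · have h1 := (mem_step_M.1 hx).2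
    have h2 := hwidth x
    have h3 := hM x hx
    have h4 := (hv x).2
    linarith

/-! ### The cost of an epoch -/

variable (cfg) in
/-- The covering cost of epoch `i` for the objective `c`. -/
noncomputable def epochCover (c : X → ℝ) (i : ℕ) : ℝ :=
  cfg.coverCost (cfg.η i / √(cfg.β i)) (cfg.η i / (√(cfg.β i) * (1 + cfg.εrel)))
    (cfg.hardU c (i - 1)) (cfg.hardM c (i - 1))

variable (cfg) in
/-- A bound on the excess variance at the start of epoch `i`. -/
noncomputable def epochExcess (c : X → ℝ) (i : ℕ) : ℝ :=
  cfg.β i * (((cfg.hardU c (i - 1)).card : ℝ) + (1 + cfg.εrel) ^ 2 * (cfg.hardM c (i - 1)).card)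

variable (cfg) in
/-- What holds after each iteration of a run with valid confidence intervals. The last field says
that the excess variance has decayed exponentially with the cost spent since the total cost was
`K₀`, which is at the start of the current epoch. -/
structure Invariant (c : X → ℝ) (C : ℕ → ℝ) {t : ℕ} (s : State X t) : Prop where
  one_le_epoch : 1 ≤ s.epoch
  minimizer : ∃ x ∈ s.M, c x = ⨅ z, c z
  le_of_mem_L : ∀ x ∈ s.L, c x ≤ cfg.threshold c
  lt_of_mem_H : ∀ x ∈ s.H, cfg.threshold c < c x
  U_subset : s.U ⊆ cfg.hardU c (s.epoch - 1)
  M_subset : s.M ⊆ cfg.hardM c (s.epoch - 1)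
  not_done : t ≠ 0 → ¬ cfg.epochDone s.pts s.U s.M s.epoch
  decay : ∃ K₀ ≤ ∑ j ∈ Finset.Icc 1 (s.epoch - 1), C j, ∀ B, cfg.epochCover c s.epoch < B →
    cfg.potential s.epoch s.U s.M s.pts * Real.exp ((cfg.totalCost s - K₀) / B)
      ≤ cfg.epochExcess c s.epoch

theorem sum_Icc_eq {C : ℕ → ℝ} {i : ℕ} (hi : 1 ≤ i) :
    ∑ j ∈ Finset.Icc 1 i, C j = ∑ j ∈ Finset.Icc 1 (i - 1), C j + C i := by
  obtain ⟨n, rfl⟩ := Nat.exists_eq_add_of_le' hi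
  rw [Nat.add_sub_cancel, Finset.sum_Icc_succ_top (by omega)]

theorem cost_le_iSup (x : X) : cfg.cost x ≤ ⨆ x, cfg.cost x :=
  le_ciSup (Set.finite_range cfg.cost).bddAbove x

theorem exists_mem_argmaxSet [Nonempty X] (s : State X t) : (cfg.argmaxSet s).Nonempty := by
  obtain ⟨x, hx⟩ := Finite.exists_max (cfg.acquisition s)
  exact ⟨x, by simpa [argmaxSet] using hx⟩

variable [DecidableEq X] {c : X → ℝ} {C : ℕ → ℝ}

theorem iSup_cost_le (hA : cfg.Admissible) (hC : cfg.CostBound c C) {i : ℕ} (hi : 1 ≤ i) :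
    ⨆ x, cfg.cost x ≤ C i := by
  refine le_trans ?_ (hC i hi)
  exact le_add_of_nonneg_left (mul_nonneg (coverCost_nonneg hA _ _ _ _) (le_max_right _ _))

theorem sum_Icc_mono [Nonempty X] (hA : cfg.Admissible) (hC : cfg.CostBound c C) {i j : ℕ}
    (hij : i ≤ j) : ∑ l ∈ Finset.Icc 1 i, C l ≤ ∑ l ∈ Finset.Icc 1 j, C l := by
  refine Finset.sum_le_sum_of_subset_of_nonneg (Finset.Icc_subset_Icc_right hij) fun l hl _ => ?_
  obtain ⟨x⟩ := ‹Nonempty X›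
  exact ((hA.cost_pos x).le.trans (cost_le_iSup x)).trans
    (iSup_cost_le hA hC (Finset.mem_Icc.1 hl).1)

/-- An epoch that is not done leaves room for one more evaluation in its cost bound. -/
theorem Invariant.totalCost_add_le (hA : cfg.Admissible) (hC : cfg.CostBound c C)
    (h : cfg.Invariant c C s) (hβ : 0 ≤ cfg.β s.epoch)
    (hd : ¬ cfg.epochDone s.pts s.U s.M s.epoch) :
    cfg.totalCost s + ⨆ x, cfg.cost x ≤ ∑ j ∈ Finset.Icc 1 s.epoch, C j := by
  obtain ⟨K₀, hK₀, hdec⟩ := h.decay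
  have hCi := hC s.epoch h.one_le_epoch
  rw [sum_Icc_eq h.one_le_epoch]
  set e := cfg.slack ^ 2 * cfg.η s.epoch ^ 2 with he
  have he0 : 0 < e := by have := hA.slack_pos; have := hA.eta_pos s.epoch; positivity
  set L := max (Real.log (cfg.epochExcess c s.epoch / e)) 0 with hL
  have hL0 : 0 ≤ L := le_max_right _ _
  have hcov : 0 ≤ cfg.epochCover c s.epoch := coverCost_nonneg hA _ _ _ _
  have key : ∀ B, cfg.epochCover c s.epoch < B → cfg.totalCost s - K₀ ≤ B * L := by
    intro B hB
    have hB0 : 0 < B := hcov.trans_lt hB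
    have h1 : e * Real.exp ((cfg.totalCost s - K₀) / B) ≤ cfg.epochExcess c s.epoch :=
      (mul_le_mul_of_nonneg_right (lt_potential_of_not_epochDone hA hβ hd).le
        (Real.exp_pos _).le).trans (hdec B hB)
    have h2 : Real.exp ((cfg.totalCost s - K₀) / B) ≤ cfg.epochExcess c s.epoch / e := by
      rwa [le_div_iff₀ he0, mul_comm]
    have h3 := (Real.le_log_iff_exp_le ((Real.exp_pos _).trans_le h2)).2 h2
    have h4 := h3.trans (le_max_left _ 0)
    rwa [div_le_iff₀ hB0, mul_comm] at h4
  have hlim : cfg.totalCost s - K₀ ≤ cfg.epochCover c s.epoch * L := by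
    refine le_of_forall_pos_le_add fun ε hε => ?_
    have h1 := key (cfg.epochCover c s.epoch + ε / (L + 1)) (by
      have : 0 < ε / (L + 1) := by positivity
      linarith)
    have h2 : ε / (L + 1) * L ≤ ε := by
      rw [div_mul_eq_mul_div, div_le_iff₀ (by positivity)]
      nlinarith
    linarith
  have hCi' : cfg.epochCover c s.epoch * L + ⨆ x, cfg.cost x ≤ C s.epoch := hCi
  linarith

theorem Invariant.totalCost_step_le (hA : cfg.Admissible) (hC : cfg.CostBound c C) [Nonempty X]
    (h : cfg.Invariant c C s) (hβ : 0 ≤ cfg.β s.epoch) :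
    cfg.totalCost (cfg.step pick y s) ≤ ∑ j ∈ Finset.Icc 1 s.epoch, C j := by
  rw [totalCost_step]
  have h1 := cost_le_iSup (cfg := cfg) (pick (cfg.argmaxSet s))
  rcases eq_or_ne t 0 with rfl | ht
  · have h2 := sum_Icc_mono hA hC h.one_le_epoch
    have h3 := iSup_cost_le hA hC le_rfl
    simp only [totalCost, Finset.univ_eq_empty, Finset.sum_empty, zero_add]
    simp only [Finset.Icc_self, Finset.sum_singleton] at h2
    exact h1.trans (h3.trans h2)
  · have := h.totalCost_add_le hA hC hβ (h.not_done ht)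
    linarith

theorem potential_le_epochExcess (hA : cfg.Admissible) {i : ℕ} (hβ : 0 ≤ cfg.β i)
    {U M : Finset X} (hU : U ⊆ cfg.hardU c (i - 1)) (hM : M ⊆ cfg.hardM c (i - 1))
    (p : Fin t → X) : cfg.potential i U M p ≤ cfg.epochExcess c i := by
  refine (potential_le_card hA hβ U M p).trans (mul_le_mul_of_nonneg_left ?_ hβ)
  have h1 : (U.card : ℝ) ≤ (cfg.hardU c (i - 1)).card := by exact_mod_cast Finset.card_le_card hU
  have h2 : (M.card : ℝ) ≤ (cfg.hardM c (i - 1)).card := by exact_mod_cast Finset.card_le_card hM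
  have h3 : 0 ≤ (1 + cfg.εrel) ^ 2 := by positivity
  exact add_le_add h1 (mul_le_mul_of_nonneg_left h2 h3)

theorem invariant_init [Nonempty X] (hA : cfg.Admissible) (hβ : 0 ≤ cfg.β 1) :
    cfg.Invariant c C (init : State X 0) where
  one_le_epoch := le_rfl
  minimizer := by
    obtain ⟨x, hx⟩ := exists_eq_ciInf_of_finite (f := c)
    exact ⟨x, Finset.mem_univ x, hx⟩
  le_of_mem_L := fun x hx => absurd hx (Finset.notMem_empty x)
  lt_of_mem_H := fun x hx => absurd hx (Finset.notMem_empty x)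
  U_subset := fun x _ => by simp [init, hardU]
  M_subset := fun x _ => by simp [init, hardM]
  not_done := fun h => absurd rfl h
  decay := by
    refine ⟨0, by simp [init], fun B _ => ?_⟩
    have : cfg.potential 1 Finset.univ Finset.univ (init : State X 0).pts ≤ cfg.epochExcess c 1 :=
      potential_le_epochExcess hA hβ (fun x _ => by simp [hardU]) (fun x _ => by simp [hardM]) _
    simpa [totalCost, init] using this

/-- Within an epoch the greedy step preserves the decay of the excess variance; at the start of a
new epoch, the loop condition of the epoch just finished puts the survivors into the hard sets. -/
theorem Invariant.step [Nonempty X] (hA : cfg.Admissible)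
    (hC : cfg.CostBound c C) (hβ : ∀ i, 1 ≤ i → 0 < cfg.β i)
    (hpick : ∀ A, A.Nonempty → pick A ∈ A) (h : cfg.Invariant c C s)
    (hv : ∀ x, cfg.stepLower pick y s x ≤ c x ∧ c x ≤ cfg.stepUpper pick y s x)
    (hhalt : ∃ j, s.epoch ≤ j ∧ ¬ cfg.epochDone (cfg.step pick y s).pts (cfg.step pick y s).U
      (cfg.step pick y s).M j) :
    cfg.Invariant c C (cfg.step pick y s) := by
  have hrel := hA.one_add_rel_pos
  have hs1 := h.one_le_epoch
  obtain ⟨hle, hnd, hdone⟩ := nextEpoch_spec hhalt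
  have hUs : (cfg.step pick y s).U ⊆ s.U := Finset.filter_subset _ _
  have hMs : (cfg.step pick y s).M ⊆ s.M := Finset.filter_subset _ _
  have hepoch : (cfg.step pick y s).epoch = cfg.nextEpoch (cfg.step pick y s).pts
    (cfg.step pick y s).U (cfg.step pick y s).M s.epoch := rfl
  rw [← hepoch] at hle hnd hdone
  rcases hle.eq_or_lt with heq | hlt
  -- The epoch continues.
  · have hUsub : (cfg.step pick y s).U ⊆ cfg.hardU c ((cfg.step pick y s).epoch - 1) := by
      rw [← heq]; exact hUs.trans h.U_subset
    have hMsub : (cfg.step pick y s).M ⊆ cfg.hardM c ((cfg.step pick y s).epoch - 1) := by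
      rw [← heq]; exact hMs.trans h.M_subset
    refine ⟨hs1.trans hle, step_minimizer hv h.minimizer,
      le_threshold_of_mem_step_L hrel.le hv h.minimizer h.le_of_mem_L,
      threshold_lt_of_mem_step_H hrel.le hv h.minimizer h.lt_of_mem_H, hUsub, hMsub,
      fun _ => hnd, ?_⟩
    obtain ⟨K₀, hK₀, hdec⟩ := h.decay
    rw [← heq]
    refine ⟨K₀, hK₀, fun B hB => le_trans ?_ (hdec B hB)⟩
    obtain ⟨n, S, hSB, hSU, hSM⟩ := exists_cover_lt hA (hβ _ hs1) _ _ hB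
    have hB0 : 0 < B := (coverCost_nonneg hA _ _ _ _).trans_lt hB
    have hargmax : ∀ x, cfg.acquisition s x ≤ cfg.acquisition s (pick (cfg.argmaxSet s)) := by
      have := hpick _ (exists_mem_argmaxSet (cfg := cfg) s)
      simpa [argmaxSet] using this
    have hg := potential_greedy hA s (hβ _ hs1).le S hB0 hSB.le
      (fun x hx => hSU x (h.U_subset hx)) (fun x hx => hSM x (h.M_subset hx)) hargmax
    set b := pick (cfg.argmaxSet s) with hb
    have hexp : 1 - cfg.cost b / B ≤ Real.exp (-(cfg.cost b / B)) := by
      have := Real.add_one_le_exp (-(cfg.cost b / B)); linarith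
    have hpot : cfg.potential s.epoch (cfg.step pick y s).U (cfg.step pick y s).M
        (cfg.step pick y s).pts ≤ Real.exp (-(cfg.cost b / B))
          * cfg.potential s.epoch s.U s.M s.pts :=
      (cfg.potential_mono_set _ hUs hMs _).trans (hg.trans
        (mul_le_mul_of_nonneg_right hexp (cfg.potential_nonneg _ _ _ _)))
    refine (mul_le_mul_of_nonneg_right hpot (Real.exp_pos _).le).trans_eq ?_
    rw [totalCost_step, mul_comm (Real.exp _), mul_assoc, ← Real.exp_add]
    congr 2
    ring
  -- A new epoch `i'` starts, and the loop condition held for `i' - 1`.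
  · obtain ⟨i, hi⟩ : ∃ i, (cfg.step pick y s).epoch = i + 1 :=
      Nat.exists_eq_succ_of_ne_zero (by omega)
    have hsi : s.epoch ≤ i := by omega
    have hi0 : i ≠ 0 := by omega
    obtain ⟨hdU, hdM⟩ := hdone i hsi (by omega)
    have hβle : √(cfg.β s.epoch) ≤ √(cfg.β i) :=
      Real.sqrt_le_sqrt (hA.beta_mono hs1 (hs1.trans hsi) hsi)
    obtain ⟨hU, hM⟩ := step_hard hrel hv h.minimizer (w := (1 + cfg.slack) * cfg.η i)
      (fun x hx => (mul_le_mul_of_nonneg_right hβle (Real.sqrt_nonneg _)).trans (hdU x hx))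
      (fun x hx => (mul_le_mul_of_nonneg_right hβle (Real.sqrt_nonneg _)).trans
        ((hdM x hx).trans_eq (by ring)))
    have hUsub : (cfg.step pick y s).U ⊆ cfg.hardU c ((cfg.step pick y s).epoch - 1) := by
      rw [hi, Nat.add_sub_cancel]
      intro x hx
      simp only [hardU, if_neg hi0, Finset.mem_filter, Finset.mem_univ, true_and]
      exact (hU x hx).trans_eq (by ring)
    have hMsub : (cfg.step pick y s).M ⊆ cfg.hardM c ((cfg.step pick y s).epoch - 1) := by
      rw [hi, Nat.add_sub_cancel]
      intro x hx
      simp only [hardM, if_neg hi0, Finset.mem_filter, Finset.mem_univ, true_and]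
      exact (hM x hx).trans_eq (by ring)
    refine ⟨hs1.trans hle, step_minimizer hv h.minimizer,
      le_threshold_of_mem_step_L hrel.le hv h.minimizer h.le_of_mem_L,
      threshold_lt_of_mem_step_H hrel.le hv h.minimizer h.lt_of_mem_H, hUsub, hMsub,
      fun _ => hnd, cfg.totalCost (cfg.step pick y s), ?_, fun B _ => ?_⟩
    · rw [hi, Nat.add_sub_cancel]
      exact (h.totalCost_step_le hA hC (hβ _ hs1).le).trans (sum_Icc_mono hA hC hsi)
    · rw [sub_self, zero_div, Real.exp_zero, mul_one]
      exact potential_le_epochExcess hA (hβ _ (hs1.trans hle)).le hUsub hMsub _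

end Config

/-! ### Runs with valid confidence intervals -/

/-- The squared width factor of the confidence intervals that hold for all `N` points after `t`
observations, simultaneously over all `t ≥ 1`, with probability `1 - δ`. -/
noncomputable def confBeta (N : ℕ) (δ : ℝ) (t : ℕ) : ℝ :=
  2 * Real.log (N * (t : ℝ) ^ 2 * Real.pi ^ 2 / (6 * δ))

theorem one_lt_confBeta_arg {N t : ℕ} {δ : ℝ} (hN : 1 ≤ N) (ht : 1 ≤ t) (hδ0 : 0 < δ)
    (hδ1 : δ < 1) : 1 < N * (t : ℝ) ^ 2 * Real.pi ^ 2 / (6 * δ) := by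
  rw [one_lt_div (by positivity)]
  have h1 : (1 : ℝ) ≤ N := by exact_mod_cast hN
  have h2 : (1 : ℝ) ≤ (t : ℝ) ^ 2 := one_le_pow₀ (by exact_mod_cast ht)
  have h3 := Real.pi_gt_three
  have h4 : (1 : ℝ) ≤ N * (t : ℝ) ^ 2 := one_le_mul_of_one_le_of_one_le h1 h2
  have h5 : Real.pi ^ 2 ≤ N * (t : ℝ) ^ 2 * Real.pi ^ 2 :=
    le_mul_of_one_le_left (by positivity) h4
  nlinarith

theorem confBeta_pos {N t : ℕ} {δ : ℝ} (hN : 1 ≤ N) (ht : 1 ≤ t) (hδ0 : 0 < δ) (hδ1 : δ < 1) :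
    0 < confBeta N δ t :=
  mul_pos two_pos (Real.log_pos (one_lt_confBeta_arg hN ht hδ0 hδ1))

namespace Config

theorem run_M_nonempty {X : Type*} [Fintype X] [Nonempty X] {cfg : Config X} {c : X → ℝ}
    {pick : ℕ → Finset X → X} {e : ℕ → X → ℝ} (t : ℕ) : (cfg.run pick c e t).M.Nonempty := by
  induction t with
  | zero => exact Finset.univ_nonempty
  | succ t ih => exact step_M_nonempty ih

theorem mul_iInf_cost_le {X : Type*} [Fintype X] {cfg : Config X} {t : ℕ} (s : State X t) :
    t * ⨅ x, cfg.cost x ≤ cfg.totalCost s := by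
  have h := Finset.card_nsmul_le_sum Finset.univ (fun j => cfg.cost (s.pts j)) (⨅ x, cfg.cost x)
    (fun j _ => ciInf_le (Set.finite_range cfg.cost).bddBelow _)
  simpa [totalCost] using h

variable {X : Type*} [Fintype X] [DecidableEq X] [Nonempty X] {cfg : Config X} {c : X → ℝ}
  {C : ℕ → ℝ} {δ : ℝ}

theorem iInf_cost_pos (hA : cfg.Admissible) : 0 < ⨅ x, cfg.cost x := by
  obtain ⟨x, hx⟩ := exists_eq_ciInf_of_finite (f := cfg.cost)
  rw [← hx]
  exact hA.cost_pos x

theorem confBeta_le (hA : cfg.Admissible) (hδ0 : 0 < δ) (hconf : cfg.ConfidenceBound δ C)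
    {i t : ℕ} (hi : 1 ≤ i) (ht : 1 ≤ t)
    (h : t * ⨅ x, cfg.cost x ≤ ∑ j ∈ Finset.Icc 1 i, C j) :
    confBeta (Fintype.card X) δ t ≤ cfg.β i := by
  refine le_trans ?_ (hconf i hi)
  have hm := iInf_cost_pos hA
  have hN : (0 : ℝ) < Fintype.card X := by exact_mod_cast Fintype.card_pos
  have ht' : (0 : ℝ) < t := by exact_mod_cast ht
  refine mul_le_mul_of_nonneg_left (Real.log_le_log (by positivity) ?_) two_pos.le
  have h2 : (t : ℝ) ^ 2 ≤ (∑ j ∈ Finset.Icc 1 i, C j) ^ 2 / (⨅ x, cfg.cost x) ^ 2 := by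
    rw [le_div_iff₀ (by positivity), ← mul_pow]
    exact pow_le_pow_left₀ (by positivity) h 2
  calc (Fintype.card X : ℝ) * (t : ℝ) ^ 2 * Real.pi ^ 2 / (6 * δ)
      ≤ (Fintype.card X : ℝ) * ((∑ j ∈ Finset.Icc 1 i, C j) ^ 2 / (⨅ x, cfg.cost x) ^ 2)
          * Real.pi ^ 2 / (6 * δ) := by gcongr
    _ = _ := by field_simp

theorem beta_pos (hA : cfg.Admissible) (hδ0 : 0 < δ) (hδ1 : δ < 1) (hC : cfg.CostBound c C)
    (hconf : cfg.ConfidenceBound δ C) {i : ℕ} (hi : 1 ≤ i) : 0 < cfg.β i := by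
  refine (confBeta_pos Fintype.card_pos le_rfl hδ0 hδ1).trans_le
    (confBeta_le hA hδ0 hconf hi le_rfl ?_)
  obtain ⟨x⟩ := ‹Nonempty X›
  have h1 := ciInf_le (Set.finite_range cfg.cost).bddBelow x
  have h2 := cost_le_iSup (cfg := cfg) x
  have h3 := iSup_cost_le hA hC le_rfl
  have h4 := sum_Icc_mono hA hC hi
  rw [Finset.Icc_self, Finset.sum_singleton] at h4
  rw [Nat.cast_one, one_mul]
  linarith

variable {pick : ℕ → Finset X → X} {e : ℕ → X → ℝ}

variable (cfg pick c e δ) in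
/-- All confidence intervals with the width factor `confBeta` are valid in the run. -/
def ConfidenceValid : Prop :=
  ∀ t, 1 ≤ t → ∀ x,
    |c x - postMean cfg.k cfg.noiseVar (cfg.run pick c e t).pts (cfg.run pick c e t).obs x|
      ≤ √(confBeta (Fintype.card X) δ t) * postStd cfg.k cfg.noiseVar (cfg.run pick c e t).pts x

theorem invariant_run (hA : cfg.Admissible) (hδ0 : 0 < δ) (hδ1 : δ < 1) (hC : cfg.CostBound c C)
    (hconf : cfg.ConfidenceBound δ C) (hpick : ∀ t A, A.Nonempty → pick t A ∈ A)
    (hgood : cfg.ConfidenceValid c δ pick e) (t : ℕ)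
    (hhalt : ∀ m < t, cfg.LoopHalts pick c e m) :
    cfg.Invariant c C (cfg.run pick c e t) := by
  have hβ : ∀ i, 1 ≤ i → 0 < cfg.β i := fun i hi => beta_pos hA hδ0 hδ1 hC hconf hi
  induction t with
  | zero => exact invariant_init hA (hβ 1 le_rfl).le
  | succ t ih =>
    have h := ih fun m hm => hhalt m (hm.trans t.lt_succ_self)
    refine h.step hA hC hβ (hpick t) (fun x => ?_) (hhalt t t.lt_succ_self)
    -- The total cost bounds the number of observations, so `β` of the current epoch suffices.
    have hb := confBeta_le hA hδ0 hconf h.one_le_epoch (Nat.le_add_left 1 t)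
      ((mul_iInf_cost_le (cfg.run pick c e (t + 1))).trans
        (h.totalCost_step_le hA hC (hβ _ h.one_le_epoch).le))
    have hg := (hgood (t + 1) (Nat.le_add_left 1 t) x).trans
      (mul_le_mul_of_nonneg_right (Real.sqrt_le_sqrt hb) (Real.sqrt_nonneg _))
    have hg' := abs_le.1 hg
    change cfg.lower (cfg.run pick c e t).epoch (cfg.run pick c e (t + 1)).pts
        (cfg.run pick c e (t + 1)).obs x ≤ c x ∧
      c x ≤ cfg.upper (cfg.run pick c e t).epoch (cfg.run pick c e (t + 1)).pts
        (cfg.run pick c e (t + 1)).obs x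
    rw [lower, upper]
    constructor <;> linarith [hg'.1, hg'.2]

/-! ### Accuracy and termination -/

/-- The epochs that enter the budget form an initial segment. -/
theorem exists_budget_eq {X : Type*} [DecidableEq X] {cfg : Config X} (hA : cfg.Admissible)
    {ε : ℝ} (hε : 0 < ε) (C : ℕ → ℝ) :
    ∃ I, 1 ≤ I ∧ 8 * (1 + cfg.slack) * cfg.η I ≤ ε ∧
      cfg.budget ε C = ∑ i ∈ Finset.Icc 1 I, C i := by
  classical
  have hδ := hA.slack_pos
  have hex : ∃ I, 1 ≤ I ∧ 8 * (1 + cfg.slack) * cfg.η I ≤ ε := by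
    have h := hA.tendsto_eta.const_mul (8 * (1 + cfg.slack))
    rw [mul_zero] at h
    obtain ⟨I, h1, h2⟩ := ((h.eventually_le_const hε).and (Filter.eventually_ge_atTop 1)).exists
    exact ⟨I, h2, h1⟩
  obtain ⟨hI1, hI2⟩ := Nat.find_spec hex
  refine ⟨Nat.find hex, hI1, hI2, ?_⟩
  suffices hset : {i : ℕ | i = 1 ∨ (2 ≤ i ∧ ε < 8 * (1 + cfg.slack) * cfg.η (i - 1))}
      = ((Finset.Icc 1 (Nat.find hex) : Finset ℕ) : Set ℕ) by
    rw [budget, hset, finsum_mem_coe_finset]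
  ext i
  rw [Set.mem_ofPred_eq, Finset.coe_Icc, Set.mem_Icc]
  constructor
  · rintro (rfl | ⟨hi, hlt⟩)
    · exact ⟨le_rfl, hI1⟩
    · refine ⟨by omega, ?_⟩
      by_contra hgt
      have h1 := hA.eta_anti (show Nat.find hex ≤ i - 1 by omega)
      have h2 := mul_le_mul_of_nonneg_left h1 (by positivity : 0 ≤ 8 * (1 + cfg.slack))
      linarith
  · rintro ⟨h1, h2⟩
    rcases h1.eq_or_lt with h | h
    · exact Or.inl h.symm
    · refine Or.inr ⟨h, ?_⟩
      have h3 := Nat.find_min hex (show i - 1 < Nat.find hex by omega)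
      push Not at h3
      exact h3 (by omega)

theorem accurate_of_returnsAt (hA : cfg.Admissible) (hδ0 : 0 < δ) (hδ1 : δ < 1)
    (hC : cfg.CostBound c C) (hconf : cfg.ConfidenceBound δ C)
    (hpick : ∀ t A, A.Nonempty → pick t A ∈ A) (hgood : cfg.ConfidenceValid c δ pick e)
    {ε : ℝ} (hε : 0 < ε) {T : ℕ} (hT : cfg.ReturnsAt pick c e (cfg.budget ε C) T) :
    cfg.Accurate c ε (cfg.run pick c e T) := by
  obtain ⟨hT1, hhalt, hcost, -⟩ := hT
  have h := invariant_run hA hδ0 hδ1 hC hconf hpick hgood T hhalt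
  refine ⟨h.le_of_mem_L, h.lt_of_mem_H, fun x hx => ?_⟩
  obtain ⟨I, hI1, hI2, hbudget⟩ := exists_budget_eq hA hε C
  set i := (cfg.run pick c e T).epoch with hi
  have hslack := hA.slack_pos
  -- An unfinished epoch `i ≤ I` would leave the cost below the budget.
  have hIi : I + 1 ≤ i := by
    by_contra hlt
    have h1 := h.totalCost_add_le hA hC (beta_pos hA hδ0 hδ1 hC hconf h.one_le_epoch).le
      (h.not_done (by omega))
    have h2 : ∑ j ∈ Finset.Icc 1 i, C j ≤ ∑ j ∈ Finset.Icc 1 I, C j :=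
      sum_Icc_mono hA hC (by omega)
    have h3 := (hA.cost_pos x).trans_le (cost_le_iSup x)
    linarith
  have hU := h.U_subset hx
  simp only [hardU, ← hi, if_neg (show i - 1 ≠ 0 by omega), Finset.mem_filter, Finset.mem_univ,
    true_and] at hU
  have h1 := hA.eta_anti (show I ≤ i - 1 by omega)
  have h2 := mul_le_mul_of_nonneg_left h1 (by positivity : 0 ≤ 8 * (1 + cfg.slack))
  rw [abs_sub_comm]
  linarith

/-- With positive prior variances the loops halt: a potential minimizer is left, its posterior
variance is positive, and `η` tends to zero. -/
theorem loopHalts (hA : cfg.Admissible) (hβ : 0 < cfg.β 1) (hk : ∀ x, 0 < cfg.k x x) (t : ℕ) :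
    cfg.LoopHalts pick c e t := by
  obtain ⟨x, hx⟩ := run_M_nonempty (cfg := cfg) (pick := pick) (c := c) (e := e) (t + 1)
  set σ := postStd cfg.k cfg.noiseVar (cfg.run pick c e (t + 1)).pts x with hσ
  have hσ0 : 0 < σ := Real.sqrt_pos.2 (postVar_pos hA.posSemidef hA.noise_pos _ (hk x))
  have h := hA.tendsto_eta.const_mul ((1 + cfg.slack) / (1 + cfg.εrel))
  rw [mul_zero] at h
  obtain ⟨j, hj1, hj2⟩ := ((h.eventually_lt_const (mul_pos (Real.sqrt_pos.2 hβ) hσ0)).and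
    (Filter.eventually_ge_atTop (max 1 (cfg.run pick c e t).epoch))).exists
  refine ⟨j, (le_max_right _ _).trans hj2, fun hd => ?_⟩
  have h1j := (le_max_left _ _).trans hj2
  have h3 : √(cfg.β 1) * σ ≤ √(cfg.β j) * σ := mul_le_mul_of_nonneg_right
    (Real.sqrt_le_sqrt (hA.beta_mono (Set.mem_Ici.2 le_rfl) h1j h1j)) hσ0.le
  exact absurd ((h3.trans (hd.2 x hx))) (not_le.2 hj1)

theorem exists_returnsAt (hA : cfg.Admissible) (hβ : 0 < cfg.β 1) (hk : ∀ x, 0 < cfg.k x x)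
    (B : ℝ) : ∃ T, cfg.ReturnsAt pick c e B T := by
  classical
  have hex : ∃ T, 1 ≤ T ∧ B ≤ cfg.totalCost (cfg.run pick c e T) := by
    obtain ⟨n, hn⟩ := exists_nat_ge (B / ⨅ x, cfg.cost x)
    have hm := iInf_cost_pos hA
    refine ⟨n + 1, Nat.le_add_left 1 n, le_trans ?_ (mul_iInf_cost_le _)⟩
    rw [div_le_iff₀ hm] at hn
    push_cast
    linarith
  refine ⟨Nat.find hex, (Nat.find_spec hex).1, fun t _ => loopHalts hA hβ hk t,
    (Nat.find_spec hex).2, fun t ht hlt => ?_⟩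
  have := Nat.find_min hex hlt
  push Not at this
  exact this ht

end Config

/-! ### The Gaussian tail -/

/-- Shifting the tail to the origin scales the density by at most `exp (-m² / 2v)`. -/
theorem gaussianReal_Ioi_le {v : ℝ≥0} (hv : v ≠ 0) {m : ℝ} (hm : 0 ≤ m) :
    gaussianReal 0 v (Set.Ioi m)
      ≤ ENNReal.ofReal (Real.exp (-m ^ 2 / (2 * v))) * gaussianReal 0 v (Set.Ioi 0) := by
  have hshift : gaussianReal 0 v (Set.Ioi m) = gaussianReal (-m) v (Set.Ioi 0) := by
    have h := gaussianReal_map_const_add (μ := 0) (v := v) (-m)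
    rw [zero_add] at h
    rw [← h, Measure.map_apply (by fun_prop) measurableSet_Ioi]
    congr 1
    ext x
    simp
  rw [hshift, gaussianReal_apply _ hv, gaussianReal_apply _ hv,
    ← lintegral_const_mul _ (measurable_gaussianPDF 0 v)]
  refine setLIntegral_mono (by fun_prop) fun x hx => ?_
  rw [gaussianPDF, gaussianPDF, ← ENNReal.ofReal_mul (Real.exp_pos _).le]
  refine ENNReal.ofReal_le_ofReal ?_
  rw [gaussianPDFReal, gaussianPDFReal, mul_left_comm, ← Real.exp_add]
  refine mul_le_mul_of_nonneg_left (Real.exp_le_exp.2 ?_) (by positivity)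
  have hv' : (0 : ℝ) < v := by positivity
  rw [← add_div]
  refine div_le_div_of_nonneg_right ?_ (by positivity)
  have : 0 ≤ m * x := mul_nonneg hm (le_of_lt hx)
  nlinarith

/-- The two-sided tail bound without the factor `2`. -/
theorem gaussianReal_abs_gt_le (v : ℝ≥0) {a : ℝ} (ha : 0 ≤ a) :
    gaussianReal 0 v {x | a * √v < |x|} ≤ ENNReal.ofReal (Real.exp (-a ^ 2 / 2)) := by
  rcases eq_or_ne v 0 with rfl | hv
  · simp [gaussianReal_zero_var]
  set m := a * √v with hm
  have hm0 : 0 ≤ m := by positivity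
  have hv' : (0 : ℝ) < v := by positivity
  have hneg : ∀ b : ℝ, gaussianReal 0 v (Set.Iio (-b)) = gaussianReal 0 v (Set.Ioi b) := fun b => by
    have h := gaussianReal_map_neg (μ := 0) (v := v)
    rw [neg_zero] at h
    conv_lhs => rw [← h]
    rw [Measure.map_apply measurable_neg measurableSet_Iio]
    congr 1
    ext x
    simp
  have hset : {x : ℝ | m < |x|} = Set.Ioi m ∪ Set.Iio (-m) := by
    ext x
    simp [lt_abs, lt_neg]
  have hexp : -m ^ 2 / (2 * v) = -a ^ 2 / 2 := by
    rw [hm, mul_pow, Real.sq_sqrt hv'.le]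
    field_simp
  have htail := gaussianReal_Ioi_le hv hm0
  rw [hexp] at htail
  calc gaussianReal 0 v {x | m < |x|}
      ≤ gaussianReal 0 v (Set.Ioi m) + gaussianReal 0 v (Set.Iio (-m)) :=
        hset ▸ measure_union_le _ _
    _ ≤ ENNReal.ofReal (Real.exp (-a ^ 2 / 2))
          * (gaussianReal 0 v (Set.Ioi 0) + gaussianReal 0 v (Set.Iio 0)) := by
        rw [hneg, mul_add]
        refine add_le_add htail ?_
        have h0 := hneg 0
        rw [neg_zero] at h0
        rw [h0]
        exact htail
    _ ≤ ENNReal.ofReal (Real.exp (-a ^ 2 / 2)) * 1 := by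
        refine mul_le_mul_right ?_ _
        have hd : Disjoint (Set.Ioi (0 : ℝ)) (Set.Iio 0) :=
          Set.disjoint_left.2 fun x (h1 : 0 < x) (h2 : x < 0) => lt_asymm h1 h2
        rw [← measure_union hd measurableSet_Iio]
        exact prob_le_one
    _ = _ := mul_one _

/-! ### Prediction from observations at fixed points -/

section FixedPoints

variable {X : Type*} {k : X → X → ℝ} {s2 : X → ℝ≥0} {t : ℕ}

theorem postMean_eq_sum (hK : (Matrix.of k).PosSemidef) (hs : ∀ x, 0 < s2 x) (p : Fin t → X)
    (y : Fin t → ℝ) (x : X) : postMean k s2 p y x = ∑ j, weights k s2 p x j * y j := by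
  rw [postMean, ← gram_mulVec_weights hK hs p x, dotProduct_comm,
    dotProduct_gram_mulVec_comm hK, Matrix.mulVec_mulVec,
    Matrix.mul_nonsing_inv _ (isUnit_det_gram hK hs p), Matrix.one_mulVec]
  rfl

variable {Ω : Type*} [MeasurableSpace Ω] {P : Measure Ω} [IsProbabilityMeasure P] {c : X → Ω → ℝ}

theorem kernel_posSemidef [Fintype X] (hc : ∀ x, MemLp (c x) 2 P)
    (hc_cov : ∀ x y, covariance (c x) (c y) P = k x y) : (Matrix.of k).PosSemidef := by
  refine Matrix.PosSemidef.of_dotProduct_mulVec_nonneg ?_ fun v => ?_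
  · ext x y
    simp [← hc_cov, covariance_comm (c x)]
  · have h : star v ⬝ᵥ (Matrix.of k).mulVec v
        = covariance (fun ω => ∑ x, v x * c x ω) (fun ω => ∑ x, v x * c x ω) P := by
      rw [covariance_fun_sum_fun_sum (fun x => (hc x).const_mul _) fun x => (hc x).const_mul _]
      simp only [covariance_const_mul_left, covariance_const_mul_right, hc_cov, dotProduct,
        Matrix.mulVec, Matrix.of_apply, Pi.star_apply, star_trivial, Finset.mul_sum]
      exact Finset.sum_congr rfl fun x _ => Finset.sum_congr rfl fun y _ => by ring
    rw [h, covariance_self (memLp_finsetSum _ fun x _ => (hc x).const_mul _).aemeasurable]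
    exact variance_nonneg _ _

variable {e : ℕ → X → Ω → ℝ}

/-- The noisy values at the fixed points `p`. -/
def fixedObs (c : X → Ω → ℝ) (e : ℕ → X → Ω → ℝ) (p : Fin t → X) (ω : Ω) (j : Fin t) : ℝ :=
  c (p j) ω + e j (p j) ω

/-- The error of the posterior mean at `x` from observations at the fixed points `p` is
independent of the observations, and normal with the posterior variance. -/
theorem posterior_error [Fintype X]
    (hc_gauss : IsGaussianProcess c P) (hc_mean : ∀ x, ∫ ω, c x ω ∂P = 0)
    (hc_cov : ∀ x y, covariance (c x) (c y) P = k x y)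
    (he_law : ∀ t x, HasLaw (e t x) (gaussianReal 0 (s2 x)) P)
    (he_indep : iIndepFun (fun t ω x => e t x ω) P)
    (hce_indep : IndepFun (fun ω x => c x ω) (fun ω t x => e t x ω) P)
    (hs : ∀ x, 0 < s2 x) (p : Fin t → X) (x : X) :
    IndepFun (fun ω => c x ω - postMean k s2 p (fixedObs c e p ω) x) (fixedObs c e p) P ∧
    P.map (fun ω => c x ω - postMean k s2 p (fixedObs c e p ω) x)
      = gaussianReal 0 (postVar k s2 p x).toNNReal := by
  have hcL : ∀ x, MemLp (c x) 2 P := fun x => (hc_gauss.hasGaussianLaw_eval x).memLp_two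
  have heL : ∀ t x, MemLp (e t x) 2 P := fun t x => (he_law t x).hasGaussianLaw.memLp_two
  have hK : (Matrix.of k).PosSemidef := kernel_posSemidef hcL hc_cov
  have hYL : ∀ j, MemLp (fun ω => fixedObs c e p ω j) 2 P := fun j => (hcL _).add (heL _ _)
  set w := weights k s2 p x with hw
  have hR : (fun ω => c x ω - postMean k s2 p (fixedObs c e p ω) x)
      = fun ω => c x ω - ∑ j, w j * fixedObs c e p ω j := by
    funext ω; rw [postMean_eq_sum hK hs]
  rw [hR]
  -- The objective and the noise at the chosen points are jointly Gaussian.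
  have hcG : HasGaussianLaw (fun ω x => c x ω) P := by
    let L : (↥(Finset.univ : Finset X) → ℝ) →L[ℝ] (X → ℝ) :=
      ContinuousLinearMap.pi fun x => ContinuousLinearMap.proj ⟨x, Finset.mem_univ x⟩
    exact (hc_gauss.hasGaussianLaw Finset.univ).map L
  have heI : iIndepFun (fun (j : Fin t) ω => e j (p j) ω) P :=
    (he_indep.precomp Fin.val_injective).comp (fun (j : Fin t) f => f (p j))
      fun j => measurable_pi_apply _
  have heG : HasGaussianLaw (fun ω (j : Fin t) => e j (p j) ω) P :=
    heI.hasGaussianLaw fun j => (he_law _ _).hasGaussianLaw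
  have hceI : IndepFun (fun ω x => c x ω) (fun ω (j : Fin t) => e j (p j) ω) P :=
    hce_indep.comp measurable_id
      (ψ := fun (f : ℕ → X → ℝ) (j : Fin t) => f j (p j)) (by fun_prop)
  have hjoint := hceI.hasGaussianLaw hcG heG
  have hce : ∀ z i, covariance (c z) (e (i : Fin t) (p i)) P = 0 := fun z i =>
    IndepFun.covariance_eq_zero (hceI.comp (measurable_pi_apply z) (measurable_pi_apply i))
      (hcL z) (heL _ _)
  have hee : ∀ i j : Fin t, covariance (e i (p i)) (e j (p j)) P
      = if i = j then (s2 (p i) : ℝ) else 0 := fun i j => by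
    split_ifs with hij
    · subst hij
      rw [covariance_self (heL _ _).aemeasurable, (he_law _ _).variance_eq,
        variance_id_gaussianReal]
    · exact (heI.indepFun hij).covariance_eq_zero (heL _ _) (heL _ _)
  have hcY : ∀ z j, covariance (c z) (fun ω => fixedObs c e p ω j) P = k z (p j) := fun z j => by
    change covariance (c z) (c (p j) + e j (p j)) P = _
    rw [covariance_add_right (hcL _) (hcL _) (heL _ _), hc_cov, hce, add_zero]
  have hYY : ∀ i j, covariance (fun ω => fixedObs c e p ω i) (fun ω => fixedObs c e p ω j) P
      = gram k s2 p i j := fun i j => by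
    change covariance (c (p i) + e i (p i)) (fun ω => fixedObs c e p ω j) P = _
    rw [covariance_add_left (hcL _) (heL _ _) (hYL _), hcY]
    change _ + covariance (e i (p i)) (c (p j) + e j (p j)) P = _
    rw [covariance_add_right (heL _ _) (hcL _) (heL _ _), covariance_comm (e i (p i)), hce, hee,
      zero_add]
    rfl
  have hSL : MemLp (fun ω => ∑ j, w j * fixedObs c e p ω j) 2 P :=
    memLp_finsetSum _ fun j _ => (hYL j).const_mul _
  have hRL : MemLp (fun ω => c x ω - ∑ j, w j * fixedObs c e p ω j) 2 P := (hcL x).sub hSL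
  have hgw := gram_mulVec_weights hK hs p x
  have hRY : ∀ j, covariance (fun ω => c x ω - ∑ j, w j * fixedObs c e p ω j)
      (fun ω => fixedObs c e p ω j) P = 0 := fun j => by
    rw [covariance_fun_sub_left (hcL x) hSL (hYL j), hcY,
      covariance_fun_sum_left (fun i => (hYL i).const_mul _) (hYL j)]
    simp only [covariance_const_mul_left, hYY]
    have h := congrFun hgw j
    rw [Matrix.mulVec, dotProduct, crossCov] at h
    rw [kernel_symm hK, ← h, sub_eq_zero]
    refine Finset.sum_congr rfl fun i _ => ?_
    rw [mul_comm, ← hw, ← Matrix.transpose_apply (gram k s2 p) j i, gram_transpose hK]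
  have hlin : HasGaussianLaw (fun ω => (fun _ : Unit => c x ω - ∑ j, w j * fixedObs c e p ω j,
      fun j => fixedObs c e p ω j)) P := by
    let F : (X → ℝ) × (Fin t → ℝ) →L[ℝ] (Fin t → ℝ) := ContinuousLinearMap.pi fun j =>
      (ContinuousLinearMap.proj (R := ℝ) (φ := fun _ : X => ℝ) (p j)).comp
        (ContinuousLinearMap.fst ℝ _ _)
        + (ContinuousLinearMap.proj (R := ℝ) (φ := fun _ : Fin t => ℝ) j).comp
          (ContinuousLinearMap.snd ℝ _ _)
    let G : (X → ℝ) × (Fin t → ℝ) →L[ℝ] (Unit → ℝ) := ContinuousLinearMap.pi fun _ =>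
      (ContinuousLinearMap.proj (R := ℝ) (φ := fun _ : X => ℝ) x).comp
        (ContinuousLinearMap.fst ℝ _ _)
        - ∑ j, w j • (ContinuousLinearMap.proj (R := ℝ) (φ := fun _ : Fin t => ℝ) j).comp F
    have h := hjoint.map_fun (G.prod F)
    convert! h using 3 with ω
    funext _
    simp [G, F, fixedObs, mul_add]
  have hind := hlin.indepFun_of_covariance_eval fun _ j => hRY j
  refine ⟨hind.comp (measurable_pi_apply ()) measurable_id, ?_⟩
  rw [(hlin.fst.eval ()).map_eq_gaussianReal]
  have hYm : ∀ j, ∫ ω, fixedObs c e p ω j ∂P = 0 := fun j => by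
    simp only [fixedObs]
    rw [integral_add ((hcL _).integrable one_le_two) ((heL _ _).integrable one_le_two), hc_mean,
      (he_law _ _).integral_eq, integral_id_gaussianReal, add_zero]
  congr 2
  · rw [integral_sub ((hcL x).integrable one_le_two) (hSL.integrable one_le_two), hc_mean,
      integral_finsetSum _ fun j _ => ((hYL j).const_mul _).integrable one_le_two]
    simp [integral_const_mul, hYm]
  · rw [← covariance_self hRL.aemeasurable,
      covariance_fun_sub_right hRL (hcL x) hSL,
      covariance_fun_sum_right (fun j => (hYL j).const_mul _) hRL]
    simp only [covariance_const_mul_right, hRY, mul_zero, Finset.sum_const_zero, sub_zero]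
    rw [covariance_fun_sub_left (hcL x) hSL (hcL x), hc_cov,
      covariance_fun_sum_left (fun i => (hYL i).const_mul _) (hcL x)]
    simp only [covariance_const_mul_left, covariance_comm (fun ω => fixedObs c e p ω _) (c x), hcY]
    rw [postVar, ← weights, dotProduct]
    congr 1
    exact Finset.sum_congr rfl fun j _ => by
      rw [crossCov, kernel_symm hK x, mul_comm]

end FixedPoints

/-! ### The run as a function of the observations -/

theorem measurable_postMean {X : Type*} {k : X → X → ℝ} {s2 : X → ℝ≥0} {t : ℕ} (p : Fin t → X)
    (x : X) : Measurable fun o : Fin t → ℝ => postMean k s2 p o x := by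
  simp only [postMean, dotProduct, Matrix.mulVec]
  fun_prop

namespace Config

variable {X : Type*} [Fintype X] {cfg : Config X} {pick : ℕ → Finset X → X}

theorem step_congr {pk : Finset X → X} {y y' : X → ℝ} {t : ℕ} {s : State X t}
    (h : y (pk (cfg.argmaxSet s)) = y' (pk (cfg.argmaxSet s))) :
    cfg.step pk y s = cfg.step pk y' s :=
  calc cfg.step pk y s = cfg.step pk (fun _ => y (pk (cfg.argmaxSet s))) s := rfl
    _ = cfg.step pk (fun _ => y' (pk (cfg.argmaxSet s))) s := by rw [h]
    _ = cfg.step pk y' s := rfl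

/-- Runs agree as long as the values observed at the evaluated points agree. -/
theorem run_congr {c c' : X → ℝ} {e e' : ℕ → X → ℝ} (t : ℕ)
    (h : ∀ m < t, c (pick m (cfg.argmaxSet (cfg.run pick c e m)))
        + e m (pick m (cfg.argmaxSet (cfg.run pick c e m)))
      = c' (pick m (cfg.argmaxSet (cfg.run pick c e m)))
        + e' m (pick m (cfg.argmaxSet (cfg.run pick c e m)))) :
    cfg.run pick c e t = cfg.run pick c' e' t := by
  induction t with
  | zero => rfl
  | succ t ih =>
    have h1 := ih fun m hm => h m (hm.trans t.lt_succ_self)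
    rw [run, run, ← h1]
    exact step_congr (h t t.lt_succ_self)

theorem run_pts (c : X → ℝ) (e : ℕ → X → ℝ) (t : ℕ) (j : Fin t) :
    (cfg.run pick c e t).pts j = pick j (cfg.argmaxSet (cfg.run pick c e j)) := by
  induction t with
  | zero => exact j.elim0
  | succ t ih =>
    refine Fin.lastCases ?_ (fun j => ?_) j
    · exact Fin.snoc_last (α := fun _ => X) _ _
    · exact (Fin.snoc_castSucc (α := fun _ => X) _ _ j).trans (ih j)

theorem run_obs (c : X → ℝ) (e : ℕ → X → ℝ) (t : ℕ) (j : Fin t) :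
    (cfg.run pick c e t).obs j
      = c ((cfg.run pick c e t).pts j) + e j ((cfg.run pick c e t).pts j) := by
  induction t with
  | zero => exact j.elim0
  | succ t ih =>
    refine Fin.lastCases ?_ (fun j => ?_) j
    · rw [run_pts]
      exact Fin.snoc_last (α := fun _ => ℝ) _ _
    · have h : (cfg.run pick c e (t + 1)).pts j.castSucc = (cfg.run pick c e t).pts j :=
        Fin.snoc_castSucc (α := fun _ => X) _ _ j
      rw [h]
      exact (Fin.snoc_castSucc (α := fun _ => ℝ) _ _ j).trans (ih j)

variable (cfg pick) in
/-- The run in which the value observed in iteration `t + 1` is `y t`, wherever it is observed. -/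
noncomputable def obsRun (y : ℕ → ℝ) (t : ℕ) : State X t := cfg.run pick 0 (fun m _ => y m) t

/-- Whether the run evaluates the points `p` depends only on the values observed at the fixed
points `p`. -/
theorem run_pts_eq_iff (c : X → ℝ) (e : ℕ → X → ℝ) {t : ℕ} (p : Fin t → X) {y : ℕ → ℝ}
    (hy : ∀ j : Fin t, y j = c (p j) + e j (p j)) :
    (cfg.run pick c e t).pts = p ↔ (cfg.obsRun pick y t).pts = p := by
  constructor
  · intro h
    rw [obsRun, ← run_congr t fun m hm => ?_, h]
    have h1 := congrFun h ⟨m, hm⟩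
    rw [run_pts] at h1
    simp only at h1
    rw [h1, ← hy ⟨m, hm⟩, Pi.zero_apply, zero_add]
  · intro h
    rw [← run_congr (c := 0) (e := fun m _ => y m) t fun m hm => ?_]
    · exact h
    have h1 := congrFun h ⟨m, hm⟩
    rw [obsRun, run_pts] at h1
    simp only at h1
    rw [h1, ← hy ⟨m, hm⟩, Pi.zero_apply, zero_add]

/-- The part of a state that takes countably many values and determines, together with the
observations, the next such part. -/
def discretePart {t : ℕ} (s : State X t) : (Fin t → X) × Finset X × Finset X × ℕ :=
  (s.pts, s.U, s.M, s.epoch)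

/-- A state with given discrete part and observations. The sets `L` and `H`, which do not influence
the later course of the run, are left empty. -/
def ofDiscretePart {t : ℕ} (d : (Fin t → X) × Finset X × Finset X × ℕ) (o : Fin t → ℝ) :
    State X t :=
  { pts := d.1, obs := o, L := ∅, H := ∅, U := d.2.1, M := d.2.2.1, epoch := d.2.2.2 }

theorem obsRun_obs (y : ℕ → ℝ) (t : ℕ) : (cfg.obsRun pick y t).obs = fun j : Fin t => y j := by
  funext j
  rw [obsRun, run_obs, Pi.zero_apply, zero_add]

theorem discretePart_obsRun_succ (y : ℕ → ℝ) (t : ℕ) :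
    discretePart (cfg.obsRun pick y (t + 1)) = discretePart (cfg.step (pick t) (fun _ => y t)
      (ofDiscretePart (discretePart (cfg.obsRun pick y t)) fun j => y j)) := by
  have h : cfg.obsRun pick y (t + 1) = cfg.step (pick t) (fun _ => y t) (cfg.obsRun pick y t) := by
    simp [obsRun, run]
  rw [h, ← obsRun_obs (cfg := cfg) (pick := pick)]
  rfl

theorem measurable_snoc_obs (t : ℕ) :
    Measurable fun y : ℕ → ℝ => (Fin.snoc (α := fun _ => ℝ) (fun j : Fin t => y j) (y t)) := by
  refine measurable_pi_lambda _ fun j => ?_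
  refine Fin.lastCases ?_ (fun j => ?_) j
  · simp only [Fin.snoc_last]; fun_prop
  · simp only [Fin.snoc_castSucc]; fun_prop

theorem measurableSet_discretePart_step {t : ℕ} (pk : Finset X → X)
    (d : (Fin t → X) × Finset X × Finset X × ℕ)
    (d' : (Fin (t + 1) → X) × Finset X × Finset X × ℕ) :
    MeasurableSet {y : ℕ → ℝ | discretePart (cfg.step pk (fun _ => y t)
      (ofDiscretePart d fun j => y j)) = d'} := by
  obtain ⟨p', U', M', i'⟩ := d'
  set s : (ℕ → ℝ) → State X t := fun y => ofDiscretePart d fun j => y j with hs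
  have hmean : ∀ x, Measurable fun y : ℕ → ℝ => postMean cfg.k cfg.noiseVar
      (cfg.step pk (fun _ => y t) (s y)).pts (cfg.step pk (fun _ => y t) (s y)).obs x := fun x =>
    (measurable_postMean (Fin.snoc (α := fun _ => X) d.1
      (pk (cfg.argmaxSet (ofDiscretePart d fun _ => 0)))) x).comp (measurable_snoc_obs t)
  have hl : ∀ x, Measurable fun y : ℕ → ℝ => cfg.stepLower pk (fun _ => y t) (s y) x := fun x =>
    (hmean x).sub_const (√(cfg.β d.2.2.2) * postStd cfg.k cfg.noiseVar
      (Fin.snoc (α := fun _ => X) d.1 (pk (cfg.argmaxSet (ofDiscretePart d fun _ => 0)))) x)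
  have hu : ∀ x, Measurable fun y : ℕ → ℝ => cfg.stepUpper pk (fun _ => y t) (s y) x := fun x =>
    (hmean x).add_const (√(cfg.β d.2.2.2) * postStd cfg.k cfg.noiseVar
      (Fin.snoc (α := fun _ => X) d.1 (pk (cfg.argmaxSet (ofDiscretePart d fun _ => 0)))) x)
  have hpes : Measurable fun y : ℕ → ℝ => ⨅ z : d.2.2.1, cfg.stepUpper pk (fun _ => y t) (s y) z :=
    Measurable.iInf fun z => hu z
  have hopt : Measurable fun y : ℕ → ℝ => ⨅ z : d.2.2.1, cfg.stepLower pk (fun _ => y t) (s y) z :=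
    Measurable.iInf fun z => hl z
  have hU : MeasurableSet {y : ℕ → ℝ | (cfg.step pk (fun _ => y t) (s y)).U = U'} := by
    simp only [Finset.ext_iff, mem_step_U]
    refine measurableSet_setOfPred.2 (Measurable.forall fun x => Measurable.iff
      ((measurable_const (a := x ∈ d.2.1)).and
        (Measurable.and (Measurable.not ?_) (Measurable.not ?_)))
      measurable_const)
    · exact measurableSet_setOfPred.1
        (measurableSet_le (hu x) ((hopt.mul_const _).add_const _))
    · exact measurableSet_setOfPred.1
        (measurableSet_lt ((hpes.mul_const _).add_const _) (hl x))
  have hM : MeasurableSet {y : ℕ → ℝ | (cfg.step pk (fun _ => y t) (s y)).M = M'} := by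
    simp only [Finset.ext_iff, mem_step_M]
    exact measurableSet_setOfPred.2 (Measurable.forall fun x => Measurable.iff
      ((measurable_const (a := x ∈ d.2.2.1)).and
        (measurableSet_setOfPred.1 (measurableSet_le (hl x) hpes)))
      measurable_const)
  -- The points do not depend on `y`, and the epoch number is a function of `U` and `M`.
  have heq : {y : ℕ → ℝ | discretePart (cfg.step pk (fun _ => y t) (s y)) = (p', U', M', i')}
      = {y | (cfg.step pk (fun _ => y t) (s y)).U = U'}
        ∩ {y | (cfg.step pk (fun _ => y t) (s y)).M = M'}
        ∩ {_y | Fin.snoc (α := fun _ => X) d.1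
            (pk (cfg.argmaxSet (ofDiscretePart d fun _ => 0))) = p'
          ∧ cfg.nextEpoch p' U' M' d.2.2.2 = i'} := by
    ext y
    have hp : (cfg.step pk (fun _ => y t) (s y)).pts = Fin.snoc (α := fun _ => X) d.1
        (pk (cfg.argmaxSet (ofDiscretePart d fun _ => 0))) := rfl
    have hi : (cfg.step pk (fun _ => y t) (s y)).epoch = cfg.nextEpoch
      (cfg.step pk (fun _ => y t) (s y)).pts (cfg.step pk (fun _ => y t) (s y)).U
      (cfg.step pk (fun _ => y t) (s y)).M d.2.2.2 := rfl
    simp only [discretePart, Set.mem_ofPred_eq, Set.mem_inter_iff, Prod.mk.injEq]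
    rw [hi, hp]
    constructor
    · rintro ⟨h1, h2, h3, h4⟩
      rw [h1, h2, h3] at h4
      exact ⟨⟨h2, h3⟩, h1, h4⟩
    · rintro ⟨⟨h2, h3⟩, h1, h4⟩
      rw [h1, h2, h3]
      exact ⟨rfl, rfl, rfl, h4⟩
  rw [heq]
  exact (hU.inter hM).inter (.const _)

theorem measurableSet_discretePart_obsRun (t : ℕ) (d : (Fin t → X) × Finset X × Finset X × ℕ) :
    MeasurableSet {y : ℕ → ℝ | discretePart (cfg.obsRun pick y t) = d} := by
  induction t with
  | zero => exact .const (discretePart (init : State X 0) = d)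
  | succ t ih =>
    have heq : {y : ℕ → ℝ | discretePart (cfg.obsRun pick y (t + 1)) = d}
        = ⋃ d₀, {y | discretePart (cfg.obsRun pick y t) = d₀}
          ∩ {y | discretePart (cfg.step (pick t) (fun _ => y t)
            (ofDiscretePart d₀ fun j => y j)) = d} := by
      ext y
      simp [discretePart_obsRun_succ]
    rw [heq]
    exact .iUnion fun d₀ => (ih d₀).inter (measurableSet_discretePart_step _ _ _)

theorem measurableSet_obsRun_pts {t : ℕ} (p : Fin t → X) :
    MeasurableSet {y : ℕ → ℝ | (cfg.obsRun pick y t).pts = p} := by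
  have heq : {y : ℕ → ℝ | (cfg.obsRun pick y t).pts = p}
      = ⋃ d : Finset X × Finset X × ℕ, {y | discretePart (cfg.obsRun pick y t) = (p, d)} := by
    ext y
    simp [discretePart]
  rw [heq]
  exact .iUnion fun d => measurableSet_discretePart_obsRun t _

end Config

namespace Config

/-! ### Validity of the confidence intervals -/

variable {X : Type*} [Fintype X] {cfg : Config X} {pick : ℕ → Finset X → X}
  {Ω : Type*} [MeasurableSpace Ω] {P : Measure Ω} [IsProbabilityMeasure P] {c : X → Ω → ℝ}
  {e : ℕ → X → Ω → ℝ}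

/-- The tail bound for the error of the posterior mean at adaptively chosen points. The event that
the run evaluates the points `p` is determined by the observations at the fixed points `p`, which
are independent of the prediction error; summing over `p` loses nothing. -/
theorem measure_error_gt_le (hs : ∀ x, 0 < cfg.noiseVar x) (hc_meas : ∀ x, Measurable (c x))
    (hc_gauss : IsGaussianProcess c P) (hc_mean : ∀ x, ∫ ω, c x ω ∂P = 0)
    (hc_cov : ∀ x y, covariance (c x) (c y) P = cfg.k x y)
    (he_meas : ∀ t x, Measurable (e t x))
    (he_law : ∀ t x, HasLaw (e t x) (gaussianReal 0 (cfg.noiseVar x)) P)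
    (he_indep : iIndepFun (fun t ω x => e t x ω) P)
    (hce_indep : IndepFun (fun ω x => c x ω) (fun ω t x => e t x ω) P)
    (t : ℕ) (x : X) {a : ℝ} (ha : 0 ≤ a) :
    P {ω | a * postStd cfg.k cfg.noiseVar (cfg.run pick (c · ω) (e · · ω) t).pts x
      < |c x ω - postMean cfg.k cfg.noiseVar (cfg.run pick (c · ω) (e · · ω) t).pts
          (cfg.run pick (c · ω) (e · · ω) t).obs x|} ≤ ENNReal.ofReal (Real.exp (-a ^ 2 / 2)) := by
  classical
  have hK : (Matrix.of cfg.k).PosSemidef :=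
    kernel_posSemidef (fun x => (hc_gauss.hasGaussianLaw_eval x).memLp_two) hc_cov
  -- Observations in the iterations after `t` are irrelevant and set to zero.
  let ext : (Fin t → ℝ) → ℕ → ℝ := fun o m => if h : m < t then o ⟨m, h⟩ else 0
  have hext : Measurable ext := by
    refine measurable_pi_lambda _ fun m => ?_
    by_cases h : m < t
    · simp only [ext, dif_pos h]; fun_prop
    · simp only [ext, dif_neg h]; fun_prop
  let G : (Fin t → X) → Set (Fin t → ℝ) := fun p =>
    ext ⁻¹' {y | (cfg.obsRun pick y t).pts = p}
  have hG : ∀ p, MeasurableSet (G p) := fun p => hext (measurableSet_obsRun_pts p)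
  have hY : ∀ p : Fin t → X, Measurable (fixedObs c e p) := fun p =>
    measurable_pi_lambda _ fun j => (hc_meas _).add (he_meas _ _)
  have hiff : ∀ (p : Fin t → X) ω,
      (cfg.run pick (c · ω) (e · · ω) t).pts = p ↔ ω ∈ fixedObs c e p ⁻¹' G p := fun p ω =>
    run_pts_eq_iff _ _ p fun j => by simp [ext, fixedObs]
  let A : (Fin t → X) → Set Ω := fun p =>
    (fun ω => c x ω - postMean cfg.k cfg.noiseVar p (fixedObs c e p ω) x) ⁻¹'
      {z | a * √(postVar cfg.k cfg.noiseVar p x).toNNReal < |z|}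
  calc P {ω | a * postStd cfg.k cfg.noiseVar (cfg.run pick (c · ω) (e · · ω) t).pts x
        < |c x ω - postMean cfg.k cfg.noiseVar (cfg.run pick (c · ω) (e · · ω) t).pts
          (cfg.run pick (c · ω) (e · · ω) t).obs x|}
      ≤ P (⋃ p, A p ∩ fixedObs c e p ⁻¹' G p) := by
        refine measure_mono fun ω hω => Set.mem_iUnion.2
          ⟨(cfg.run pick (c · ω) (e · · ω) t).pts, ?_, (hiff _ ω).1 rfl⟩
        have hobs : (cfg.run pick (c · ω) (e · · ω) t).obs
            = fixedObs c e (cfg.run pick (c · ω) (e · · ω) t).pts ω :=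
          funext fun j => run_obs _ _ _ j
        rw [Set.mem_ofPred_eq, hobs] at hω
        change _ * √((postVar cfg.k cfg.noiseVar _ x).toNNReal : ℝ) < _
        rwa [Real.coe_toNNReal _ (postVar_nonneg hK hs _ x)]
    _ ≤ ∑ p, P (A p ∩ fixedObs c e p ⁻¹' G p) := measure_iUnion_fintype_le _ _
    _ ≤ ∑ p, ENNReal.ofReal (Real.exp (-a ^ 2 / 2)) * P (fixedObs c e p ⁻¹' G p) := by
        refine Finset.sum_le_sum fun p _ => ?_
        obtain ⟨hind, hlaw⟩ := posterior_error hc_gauss hc_mean hc_cov he_law he_indep hce_indep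
          hs p x
        have hset : MeasurableSet
            {z : ℝ | a * √(postVar cfg.k cfg.noiseVar p x).toNNReal < |z|} :=
          measurableSet_lt measurable_const (by fun_prop)
        have hR : Measurable fun ω => c x ω
            - postMean cfg.k cfg.noiseVar p (fixedObs c e p ω) x :=
          (hc_meas x).sub ((measurable_postMean p x).comp (hY p))
        rw [hind.measure_inter_preimage_eq_mul _ _ hset (hG p), ← Measure.map_apply hR hset, hlaw]
        exact mul_le_mul_left (gaussianReal_abs_gt_le _ ha) _
    _ ≤ ENNReal.ofReal (Real.exp (-a ^ 2 / 2)) * 1 := by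
        rw [← Finset.mul_sum]
        refine mul_le_mul_right ?_ _
        refine (sum_measure_le_measure_univ (fun p _ => ((hY p) (hG p)).nullMeasurableSet)
          fun p _ q _ hpq => ?_).trans prob_le_one
        refine Disjoint.aedisjoint (Set.disjoint_left.2 fun ω hp hq => hpq ?_)
        rw [← (hiff p ω).2 hp, (hiff q ω).2 hq]
    _ = _ := mul_one _

/-- The width factors `confBeta` make the error probabilities summable, with sum `δ`. -/
theorem exists_confidenceValid [Nonempty X] (hs : ∀ x, 0 < cfg.noiseVar x)
    (hc_meas : ∀ x, Measurable (c x))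
    (hc_gauss : IsGaussianProcess c P) (hc_mean : ∀ x, ∫ ω, c x ω ∂P = 0)
    (hc_cov : ∀ x y, covariance (c x) (c y) P = cfg.k x y)
    (he_meas : ∀ t x, Measurable (e t x))
    (he_law : ∀ t x, HasLaw (e t x) (gaussianReal 0 (cfg.noiseVar x)) P)
    (he_indep : iIndepFun (fun t ω x => e t x ω) P)
    (hce_indep : IndepFun (fun ω x => c x ω) (fun ω t x => e t x ω) P)
    {δ : ℝ} (hδ0 : 0 < δ) (hδ1 : δ < 1) :
    ∃ E : Set Ω, MeasurableSet E ∧ ENNReal.ofReal (1 - δ) ≤ P E ∧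
      ∀ ω ∈ E, cfg.ConfidenceValid (c · ω) δ pick (e · · ω) := by
  set N := Fintype.card X with hN
  have hN0 : (0 : ℝ) < N := by exact_mod_cast Fintype.card_pos
  let bad : ℕ → X → Set Ω := fun t x =>
    {ω | √(confBeta N δ (t + 1))
        * postStd cfg.k cfg.noiseVar (cfg.run pick (c · ω) (e · · ω) (t + 1)).pts x
      < |c x ω - postMean cfg.k cfg.noiseVar (cfg.run pick (c · ω) (e · · ω) (t + 1)).pts
          (cfg.run pick (c · ω) (e · · ω) (t + 1)).obs x|}
  have hbad : ∀ t x, P (bad t x) ≤ ENNReal.ofReal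
      (δ / N * (6 / Real.pi ^ 2 * (1 / ((t + 1 : ℕ) : ℝ) ^ 2))) := by
    intro t x
    refine (measure_error_gt_le hs hc_meas hc_gauss hc_mean hc_cov he_meas he_law he_indep hce_indep
      (t + 1) x (Real.sqrt_nonneg _)).trans_eq ?_
    congr 1
    have ht : 1 ≤ t + 1 := Nat.le_add_left 1 t
    have hpos : 0 < (N : ℝ) * ((t + 1 : ℕ) : ℝ) ^ 2 * Real.pi ^ 2 / (6 * δ) := by positivity
    rw [Real.sq_sqrt (confBeta_pos Fintype.card_pos ht hδ0 hδ1).le, confBeta,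
      show ∀ z : ℝ, -(2 * z) / 2 = -z from fun z => by ring, Real.exp_neg, Real.exp_log hpos]
    field_simp
  have hsum : HasSum (fun t : ℕ => δ * (6 / Real.pi ^ 2 * (1 / ((t + 1 : ℕ) : ℝ) ^ 2))) δ := by
    have h := (hasSum_nat_add_iff' 1).2 hasSum_zeta_two
    simp only [Finset.range_one, Finset.sum_singleton, Nat.cast_zero, ne_eq, OfNat.ofNat_ne_zero,
      not_false_eq_true, zero_pow, div_zero, sub_zero] at h
    have h2 := (h.mul_left (6 / Real.pi ^ 2)).mul_left δ
    have h3 : δ * (6 / Real.pi ^ 2 * (Real.pi ^ 2 / 6)) = δ := by field_simp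
    rwa [h3] at h2
  have htotal : P (⋃ t, ⋃ x, bad t x) ≤ ENNReal.ofReal δ := by
    calc P (⋃ t, ⋃ x, bad t x) ≤ ∑' t, ∑ x, P (bad t x) :=
          (measure_iUnion_le _).trans (ENNReal.tsum_le_tsum fun t => measure_iUnion_fintype_le _ _)
      _ ≤ ∑' t : ℕ, ENNReal.ofReal (δ * (6 / Real.pi ^ 2 * (1 / ((t + 1 : ℕ) : ℝ) ^ 2))) := by
          refine ENNReal.tsum_le_tsum fun t => ?_
          refine (Finset.sum_le_sum fun x _ => hbad t x).trans_eq ?_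
          rw [Finset.sum_const, Finset.card_univ, ← hN, ← ENNReal.ofReal_nsmul, nsmul_eq_mul]
          congr 1
          field_simp
      _ = ENNReal.ofReal δ := by
          rw [← ENNReal.ofReal_tsum_of_nonneg (fun t => by positivity) hsum.summable, hsum.tsum_eq]
  refine ⟨(toMeasurable P (⋃ t, ⋃ x, bad t x))ᶜ, (measurableSet_toMeasurable _ _).compl, ?_, ?_⟩
  · rw [prob_compl_eq_one_sub (measurableSet_toMeasurable _ _), measure_toMeasurable,
      ENNReal.ofReal_sub _ hδ0.le, ENNReal.ofReal_one]
    exact tsub_le_tsub_left htotal 1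
  · intro ω hω t ht x
    by_contra hlt
    refine hω (subset_toMeasurable _ _ (Set.mem_iUnion.2 ⟨t - 1, Set.mem_iUnion.2 ⟨x, ?_⟩⟩))
    obtain ⟨m, rfl⟩ := Nat.exists_eq_add_of_le' ht
    exact not_le.1 hlt

end Config
end TruVaRImp

theorem theorem1
    {X : Type*} [Fintype X] [DecidableEq X] [Nonempty X]
    (cfg : TruVaRImp.Config X)
    -- admissible inputs of the algorithm
    (hcost : ∀ x, 0 < cfg.cost x) (hnoiseVar : ∀ x, 0 < cfg.noiseVar x)
    (hslack : 0 < cfg.slack) (hr0 : 0 < cfg.r) (hr1 : cfg.r < 1) (heta : 0 < cfg.eta1)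
    (hrel : 0 ≤ cfg.εrel) (habs : 0 ≤ cfg.εabs)
    (hβ : MonotoneOn cfg.β (Set.Ici 1))
    (pick : ℕ → Finset X → X) (hpick : ∀ t A, A.Nonempty → pick t A ∈ A)
    -- the objective is drawn from the Gaussian process with mean zero and kernel `k`
    {Ω : Type*} [MeasurableSpace Ω] (P : Measure Ω) [IsProbabilityMeasure P]
    (c : X → Ω → ℝ) (hc_meas : ∀ x, Measurable (c x)) (hc_gauss : IsGaussianProcess c P)
    (hc_mean : ∀ x, ∫ ω, c x ω ∂P = 0)
    (hc_cov : ∀ x y, covariance (c x) (c y) P = cfg.k x y)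
    -- Gaussian noise, independent across iterations and of the objective
    (e : ℕ → X → Ω → ℝ) (he_meas : ∀ t x, Measurable (e t x))
    (he_law : ∀ t x, HasLaw (e t x) (gaussianReal 0 (cfg.noiseVar x)) P)
    (he_indep : iIndepFun (fun t ω x => e t x ω) P)
    (hce_indep : IndepFun (fun ω x => c x ω) (fun ω t x => e t x ω) P)
    -- assumptions on the kernel
    (hk : ∀ x, cfg.k x x ≤ 1)
    (hsub : TruVaRImp.SubmodularVarianceReduction cfg.k cfg.noiseVar)
    (ε δ : ℝ) (hε : 0 < ε) (hδ0 : 0 < δ) (hδ1 : δ < 1) :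
    ∃ E : Set Ω, MeasurableSet E ∧ ENNReal.ofReal (1 - δ) ≤ P E ∧
      ∀ ω ∈ E, ∀ C : ℕ → ℝ,
        cfg.CostBound (fun x => c x ω) C → cfg.ConfidenceBound δ C →
          (∀ T, cfg.ReturnsAt pick (fun x => c x ω) (fun t x => e t x ω) (cfg.budget ε C) T →
            cfg.Accurate (fun x => c x ω) ε
              (cfg.run pick (fun x => c x ω) (fun t x => e t x ω) T)) ∧
          ((∀ x, 0 < cfg.k x x) →
            ∃ T, cfg.ReturnsAt pick (fun x => c x ω) (fun t x => e t x ω) (cfg.budget ε C) T) := by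
  have hA : cfg.Admissible :=
    { cost_pos := hcost
      noise_pos := hnoiseVar
      slack_pos := hslack
      r_pos := hr0
      r_lt_one := hr1
      eta1_pos := heta
      rel_nonneg := hrel
      beta_mono := hβ
      posSemidef := TruVaRImp.kernel_posSemidef
        (fun x => (hc_gauss.hasGaussianLaw_eval x).memLp_two) hc_cov
      prior_le_one := hk
      submodular := hsub }
  obtain ⟨E, hE, hPE, hvalid⟩ := TruVaRImp.Config.exists_confidenceValid (pick := pick) hnoiseVar
    hc_meas hc_gauss hc_mean hc_cov he_meas he_law he_indep hce_indep hδ0 hδ1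
  exact ⟨E, hE, hPE, fun ω hω C hC hconf =>
    ⟨fun T hT => TruVaRImp.Config.accurate_of_returnsAt hA hδ0 hδ1 hC hconf hpick (hvalid ω hω)
      hε hT,
    fun hpos => TruVaRImp.Config.exists_returnsAt hA
      (TruVaRImp.Config.beta_pos hA hδ0 hδ1 hC hconf le_rfl) hpos _⟩⟩
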